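/- Let $(X,d)$ be a compact metric space with a Borel probability measure $\nu$, and let $G$ be a countable (discrete) group acting on $X$ by Borel maps so that $\nu$ is quasi-invariant. For a quasi-invariant action $G\curvearrowright(Z,\mu)$ write $\frac{d\mu\circ g}{d\mu}$ for the Radon–Nikodym derivative, where $(\mu\circ g)(A)=\mu(gA)$, and write $R(g,x)=\log\frac{d\nu\circ g}{d\nu}(x)$ on $X$. *Ratio sets.* A real number $r$ is in the ratio set $RS(G\curvearrowright(Z,\mu))$ if for every measurable $A\subseteq Z$ of positive measure and every $\epsilon>0$ there are a measurable $A'\subseteq A$ of positive measure and $g\in G\setminus\{1\}$ with $gA'\subseteq A$ and $\left|\frac{d\mu\circ g}{d\mu}(z)-r\right|\le\epsilon$ for all $z\in A'$; and $\infty\in RS(G\curvearrowright(Z,\mu))$ if for every measurable $A$ of positive measure and every $M>0$ there are a measurable $A'\subseteq A$ of positive measure and $g\in G$ with $gA'\subseteq A$ and $\frac{d\mu\circ g}{d\mu}(z)>M$ for all $z\in A'$. The stable ratio set $SRS(G\curvearrowright(X,\nu))$ is the intersection of the sets $RS(G\curvearrowright(X\times Y,\nu\times\kappa))$ over all probability measure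 preserving actions of $G$ on standard Borel probability spaces $(Y,\kappa)$ (with the diagonal action on the product). *Stable type.* The action has stable type $III_\lambda$, $\lambda>1$, if $SRS(G\curvearrowright(X,\nu))=\{0,\infty\}\cup\{\lambda^n:n\in\mathbb Z\}$, and stable type $III_1$ if $SRS(G\curvearrowright(X,\nu))=[0,\infty]$. *Weak mixing.* $G\curvearrowright(X,\nu)$ is weak mixing if for every ergodic probability measure preserving action of $G$ on a standard Borel probability space $(K,\kappa)$ the diagonal action $G\curvearrowright(X\times K,\nu\times\kappa)$ is ergodic. *Relatively admissible family.* This is a sequence of functions $\Upsilon_n:G\times X\times X\to[0,\infty)$ $(n\in\mathbb N)$, with each $\Upsilon_n(g,\cdot,\cdot)$ Borel, together with closed sets $\Omega(n,m)\subseteq X$ $(n,m\in\mathbb N)$, such that: 1. there are $D(m)>0$ with $D(m)\to0$ as $m\to\infty$ and $\nu(\Omega(n,m))>1-D(m)$ for all $n,m$; 2. for each $m$ there is $f_m:\mathbb N\to\mathbb R$ with $f_m(n)\to0$ as $n\to\infty$ such that $d(b,b')<f_m(n)$ and $d(g^{-1}b,g^{-1}b')<f_m(n)$ whenever $b\in\Omega(n,m)$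 and $\Upsilon_n(g,b,b')>0$; 3. for each $m$ there are $C>0$ and $N$ such that for all $n>N$ and all $g\in G$, for $\nu\times\nu$-a.e. $(b,b')$ with $b\in\Omega(n,m)$ and $\Upsilon_n(g,b,b')>0$: $|R(g^{-1},b)|+|R(g^{-1},b')|<C$ and $|R(g^{-1},b)-R(g^{-1},b')|\ge 1/C$; 4. $\sum_{g\in G}\int\Upsilon_n(g,b,b')\,d\nu(b')=1$ for all $n>0$ and $b\in X$; 5. for each $m$ there are $C>0$ and $N$ such that for all $n>N$ $$\int_{\Omega(n,m)}\sum_{g\in G}\Upsilon_n(g,b,b')\,d\nu(b)\le C\quad\text{for a.e. }b'\in X,$$ $$\int_{\Omega(n,m)}\sum_{g\in G}\Upsilon_n(g,b,gb')\,\tfrac{d\nu\circ g}{d\nu}(b')\,d\nu(b)\le C\quad\text{for a.e. }b'\in X,$$ $$\int\sum_{g\in G}1_{\Omega(n,m)}(gb)\,\Upsilon_n(g,gb,b')\,\tfrac{d\nu\circ g}{d\nu}(b)\,d\nu(b')\le C\quad\text{for a.e. }b\in X.$$ **Corollary 2.3.** If $G\curvearrowright(X,\nu)$ is weak mixing and admits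 a relatively admissible family, then the action has stable type $III_\lambda$ for some $\lambda\ge1$; in particular its stable ratio set is not contained in $\{0,1,\infty\}$. -/

import Mathlib

open MeasureTheory Set Filter Topology
open scoped ENNReal NNReal

namespace StableType

universe u v

section Actions

variable {G : Type u} {Z : Type v} [Group G] [MeasurableSpace Z] [MulAction G Z]

/-- The action of `G` on `(Z, μ)` is quasi-invariant: every element of `G` preserves the class of
null sets (both inclusions hold, since the condition applies to `g` and `g⁻¹`). -/
def IsQuasiInvariant (G : Type u) {Z : Type v} [Group G] [MeasurableSpace Z] [MulAction G Z]
    (μ : Measure Z) : Prop :=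
  ∀ g : G, Measure.QuasiMeasurePreserving (fun z : Z => g • z) μ μ

/-- An ergodic quasi-invariant action: invariant measurable sets are null or conull. Same
formulation as Mathlib's `ErgodicSMul`, which covers only the measure preserving case. -/
structure IsErgodicAction (G : Type u) {Z : Type v} [Group G] [MeasurableSpace Z] [MulAction G Z]
    (μ : Measure Z) : Prop where
  quasiInvariant : IsQuasiInvariant G μ
  ae_const : ∀ s : Set Z, MeasurableSet s →
    (∀ g : G, (fun z : Z => g • z) ⁻¹' s =ᵐ[μ] s) → EventuallyConst s (ae μ)

/-- The Radon-Nikodym derivative `d(μ ∘ g)/dμ`, where `(μ ∘ g)(A) = μ (g A)`, that is, `μ ∘ g` is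
the push-forward of `μ` by `g⁻¹`. -/
noncomputable def rnAct (μ : Measure Z) (g : G) : Z → ℝ≥0∞ :=
  (μ.map (fun z : Z => g⁻¹ • z)).rnDeriv μ

/-- The logarithmic Radon-Nikodym cocycle `R(g, z) = log (d(μ ∘ g)/dμ) (z)`. -/
noncomputable def logRN (μ : Measure Z) (g : G) (z : Z) : ℝ :=
  Real.log (rnAct μ g z).toReal

/-- The finite part of the ratio set. -/
def MemRatioSetReal (G : Type u) {Z : Type v} [Group G] [MeasurableSpace Z] [MulAction G Z]
    (μ : Measure Z) (r : ℝ) : Prop :=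
  ∀ A : Set Z, MeasurableSet A → 0 < μ A → ∀ ε : ℝ, 0 < ε →
    ∃ A' : Set Z, A' ⊆ A ∧ MeasurableSet A' ∧ 0 < μ A' ∧
      ∃ g : G, g ≠ 1 ∧ (∀ z ∈ A', g • z ∈ A) ∧ ∀ z ∈ A', |(rnAct μ g z).toReal - r| ≤ ε

/-- The condition for `+∞` to be in the ratio set. -/
def MemRatioSetTop (G : Type u) {Z : Type v} [Group G] [MeasurableSpace Z] [MulAction G Z]
    (μ : Measure Z) : Prop :=
  ∀ A : Set Z, MeasurableSet A → 0 < μ A → ∀ M : ℝ, 0 < M →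
    ∃ A' : Set Z, A' ⊆ A ∧ MeasurableSet A' ∧ 0 < μ A' ∧
      ∃ g : G, (∀ z ∈ A', g • z ∈ A) ∧ ∀ z ∈ A', M < (rnAct μ g z).toReal

/-- The ratio set `RS(G ↷ (Z, μ)) ⊆ ℝ ∪ {+∞}`. -/
def ratioSet (G : Type u) {Z : Type v} [Group G] [MeasurableSpace Z] [MulAction G Z]
    (μ : Measure Z) : Set EReal :=
  {r | (∃ s : ℝ, r = (s : EReal) ∧ MemRatioSetReal G μ s) ∨ (r = ⊤ ∧ MemRatioSetTop G μ)}

/-- The stable ratio set: the intersection of the ratio sets of the diagonal actions on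
`(Z × Y, μ × κ)`, over all (not necessarily ergodic) probability measure preserving actions of `G`
on standard Borel probability spaces `(Y, κ)`. Every standard Borel space is isomorphic to one in
`Type`, so nothing is lost by fixing that universe. -/
def stableRatioSet (G : Type u) {Z : Type v} [Group G] [MeasurableSpace Z] [MulAction G Z]
    (μ : Measure Z) : Set EReal :=
  {r | ∀ (Y : Type) [MeasurableSpace Y] [StandardBorelSpace Y] [MulAction G Y]
    [MeasurableConstSMul G Y] (κ : Measure Y) [IsProbabilityMeasure κ] [SMulInvariantMeasure G Y κ],
    r ∈ ratioSet G (μ.prod κ)}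

/-- Weak mixing: the diagonal action on `(Z × K, μ × κ)` is ergodic for every ergodic probability
measure preserving action of `G` on a standard Borel probability space `(K, κ)`. -/
def IsWeakMixing (G : Type u) {Z : Type v} [Group G] [MeasurableSpace Z] [MulAction G Z]
    (μ : Measure Z) : Prop :=
  ∀ (K : Type) [MeasurableSpace K] [StandardBorelSpace K] [MulAction G K]
    [MeasurableConstSMul G K] (κ : Measure K) [IsProbabilityMeasure κ] [ErgodicSMul G K κ],
    IsErgodicAction G (μ.prod κ)

/-- Stable type `III_lam`, `lam ≥ 1`: the stable ratio set is `[0, ∞]` if `lam = 1`, and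
`{0, ∞} ∪ {lam ^ n : n ∈ ℤ}` if `lam > 1`. -/
def HasStableTypeIII (G : Type u) {Z : Type v} [Group G] [MeasurableSpace Z] [MulAction G Z]
    (μ : Measure Z) (lam : ℝ) : Prop :=
  (lam = 1 ∧ stableRatioSet G μ = Set.Icc (0 : EReal) ⊤) ∨
  (1 < lam ∧ stableRatioSet G μ =
    {(0 : EReal), ⊤} ∪ Set.range (fun n : ℤ => ((lam ^ n : ℝ) : EReal)))

end Actions

/-- The family `Υ n : G × X × X → [0, ∞)` is admissible relative to the closed sets `Ω n m`. -/
structure IsRelativelyAdmissible {G : Type u} {X : Type v} [Group G] [MetricSpace X]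
    [MeasurableSpace X] [MulAction G X] (ν : Measure X)
    (Υ : ℕ → G → X → X → ℝ≥0) (Ω : ℕ → ℕ → Set X) : Prop where
  measurable : ∀ n g, Measurable (fun p : X × X => Υ n g p.1 p.2)
  isClosed : ∀ n m, IsClosed (Ω n m)
  large : ∃ D : ℕ → ℝ, (∀ m, 0 < D m) ∧ Tendsto D atTop (𝓝 0) ∧
    ∀ n m, 1 - D m < ν.real (Ω n m)
  close : ∀ m, ∃ f : ℕ → ℝ, Tendsto f atTop (𝓝 0) ∧
    ∀ n (g : G) (b b' : X), b ∈ Ω n m → 0 < Υ n g b b' →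
      dist b b' < f n ∧ dist (g⁻¹ • b) (g⁻¹ • b') < f n
  cocycle : ∀ m, ∃ (C : ℝ) (N : ℕ), 0 < C ∧ ∀ n, N < n → ∀ g : G,
    ∀ᵐ p ∂(ν.prod ν), p.1 ∈ Ω n m → 0 < Υ n g p.1 p.2 →
      |logRN ν g⁻¹ p.1| + |logRN ν g⁻¹ p.2| < C ∧
      1 / C ≤ |logRN ν g⁻¹ p.1 - logRN ν g⁻¹ p.2|
  normalized : ∀ n, 0 < n → ∀ b : X, ∑' g : G, ∫⁻ b', (Υ n g b b' : ℝ≥0∞) ∂ν = 1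
  bounded : ∀ m, ∃ (C : ℝ) (N : ℕ), 0 < C ∧ ∀ n, N < n →
    (∀ᵐ b' ∂ν, ∫⁻ b in Ω n m, ∑' g : G, (Υ n g b b' : ℝ≥0∞) ∂ν ≤ ENNReal.ofReal C) ∧
    (∀ᵐ b' ∂ν, ∫⁻ b in Ω n m, ∑' g : G, (Υ n g b (g • b') : ℝ≥0∞) * rnAct ν g b' ∂ν
      ≤ ENNReal.ofReal C) ∧
    (∀ᵐ b ∂ν, ∫⁻ b', ∑' g : G,
      (Ω n m).indicator (fun x => (Υ n g x b' : ℝ≥0∞)) (g • b) * rnAct ν g b ∂ν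
      ≤ ENNReal.ofReal C)

end StableType

/-! The logarithms of the positive stable ratios form a closed subgroup of ℝ as soon as one of them
is nonzero (`stableLogRatios`, `isClosed_isStableLogRatio`). Such a subgroup is all of ℝ or infinite
cyclic, which gives type III_1 or III_λ; being unbounded, it also forces 0 and ∞ into the ratio set.
So a single nonzero stable logarithmic ratio suffices, and it has to be the same for every
probability measure preserving action on `Y`.

Let G act on the Maharam extension X × Y × ℝ by g(x, y, t) = (gx, gy, t + R(g, x)), and let f be a
bounded invariant function. Suppose that b, b' are close and that g⁻¹b, g⁻¹b' are close; put r =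
R(g⁻¹, b) and r' = R(g⁻¹, b'). If nearby sections of f were L¹-close, then f(b, y, t + r - r') ≈
f(b', y, t + r - r') = f(g⁻¹b', g⁻¹y, t + r) ≈ f(g⁻¹b, g⁻¹y, t + r) = f(b, y, t), so r - r' would
almost be a period of f over b. For measurable f the sections are close on average with respect to
Υ_n: approximate f by a function uniformly continuous in x, and control the errors at b, b', g⁻¹b,
g⁻¹b' by the normalization and the three integral bounds
(`IsRelativelyAdmissible.tendsto_sectionDist`).

The failure of s to be a period of f over x is measured by a function D(x, s) (`translationDefect`).
It is Lipschitz in s, comparable along G-orbits in x, and asymptotically small at |r - r'|, which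
lies in a fixed compact interval away from 0. Ergodicity of X and compactness of the interval give a
common almost everywhere zero of D there (`IsPeriodDefect.exists_common_zero`). Defects can be
added, so the finite intersection property yields one s for all defects
(`exists_forall_isPeriodDefect_zero`). Since a defect is a function on X × ℝ, whatever `Y` it came
from, this s serves every `Y`.

Finally, a period s of all invariant functions produces the logarithmic ratio -s: apply it to a
Lipschitz substitute for the indicator of the saturation of A × (-δ, δ)
(`isLogRatio_of_translationDefect_eq_zero`). -/

namespace StableType

/-! ### The Radon-Nikodym cocycle -/

section Cocycle

variable {G : Type*} {Z : Type*} [Group G] [MeasurableSpace Z] [MulAction G Z]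
  {μ : Measure Z}

lemma measurable_rnAct (g : G) : Measurable (rnAct μ g) := Measure.measurable_rnDeriv _ _

lemma measurable_logRN (g : G) : Measurable (logRN μ g) :=
  Real.measurable_log.comp (measurable_rnAct g).ennreal_toReal

lemma IsQuasiInvariant.preimage_null (hq : IsQuasiInvariant G μ) (g : G) {S : Set Z}
    (hS : μ S = 0) : μ ((fun z => g • z) ⁻¹' S) = 0 :=
  (hq g).preimage_null hS

lemma IsQuasiInvariant.preimage_pos (hq : IsQuasiInvariant G μ) (g : G) {S : Set Z}
    (hS : 0 < μ S) : 0 < μ ((fun z => g • z) ⁻¹' S) := by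
  rw [pos_iff_ne_zero] at hS ⊢
  intro h
  apply hS
  have := hq.preimage_null g⁻¹ h
  simpa [preimage_preimage] using this

/-- The logarithmic Radon-Nikodym cocycle satisfies the cocycle identity at `z`. -/
def IsCocyclePoint (G : Type*) {Z : Type*} [Group G] [MeasurableSpace Z] [MulAction G Z]
    (μ : Measure Z) (z : Z) : Prop :=
  ∀ g h : G, logRN μ (g * h) z = logRN μ g (h • z) + logRN μ h z

lemma IsCocyclePoint.one {z : Z} (hz : IsCocyclePoint G μ z) : logRN μ (1 : G) z = 0 := by
  have := hz 1 1
  simp only [mul_one, one_smul] at this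
  linarith

lemma IsCocyclePoint.inv {z : Z} (hz : IsCocyclePoint G μ z) (g : G) :
    logRN μ g⁻¹ (g • z) = - logRN μ g z := by
  have := hz g⁻¹ g
  rw [inv_mul_cancel, hz.one] at this
  linarith

section Finite

variable [IsFiniteMeasure μ]

lemma IsQuasiInvariant.map_eq_withDensity (hq : IsQuasiInvariant G μ) (g : G) :
    μ.map (fun z : Z => g⁻¹ • z) = μ.withDensity (rnAct μ g) :=
  (Measure.withDensity_rnDeriv_eq _ _ (hq g⁻¹).absolutelyContinuous).symm

lemma IsQuasiInvariant.rnAct_one : ∀ᵐ z ∂μ, rnAct μ (1 : G) z = 1 := by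
  have : rnAct μ (1 : G) = μ.rnDeriv μ := by simp [rnAct]
  rw [this]
  exact Measure.rnDeriv_self μ

end Finite

variable [MeasurableConstSMul G Z]

variable [IsFiniteMeasure μ]

lemma IsQuasiInvariant.lintegral_inv_smul (hq : IsQuasiInvariant G μ) (g : G) {φ : Z → ℝ≥0∞}
    (hφ : Measurable φ) : ∫⁻ z, φ (g⁻¹ • z) ∂μ = ∫⁻ z, rnAct μ g z * φ z ∂μ := by
  have h := lintegral_withDensity_eq_lintegral_mul μ (measurable_rnAct (μ := μ) g) hφ
  rw [← hq.map_eq_withDensity, lintegral_map hφ (measurable_const_smul _)] at h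
  exact h

/-- The chain rule: integrated over any measurable set, both sides reduce to the same integral by
changing variables along `g * h`, `h` and `g`. -/
lemma IsQuasiInvariant.rnAct_mul (hq : IsQuasiInvariant G μ) (g h : G) :
    ∀ᵐ z ∂μ, rnAct μ (g * h) z = rnAct μ h z * rnAct μ g (h • z) := by
  have hm : Measurable fun z => rnAct μ g (h • z) :=
    (measurable_rnAct g).comp (measurable_const_smul h)
  refine ae_eq_of_forall_setLIntegral_eq_of_sigmaFinite (measurable_rnAct _)
    ((measurable_rnAct h).mul hm) fun s hs _ => ?_
  have hi : Measurable (s.indicator (1 : Z → ℝ≥0∞)) := measurable_one.indicator hs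
  have e1 := hq.lintegral_inv_smul (g * h) hi
  have e2 := hq.lintegral_inv_smul h (hm.mul hi)
  have e3 := hq.lintegral_inv_smul g (hi.comp (measurable_const_smul h⁻¹))
  simp only [smul_inv_smul, Pi.mul_apply, Function.comp_apply] at e2 e3
  simp only [mul_inv_rev, mul_smul] at e1
  rw [← lintegral_indicator hs, ← lintegral_indicator hs]
  have aux : ∀ F : Z → ℝ≥0∞, s.indicator F = fun z => F z * s.indicator (1 : Z → ℝ≥0∞) z := by
    intro F; ext z; by_cases hz : z ∈ s <;> simp [hz]
  rw [aux (rnAct μ (g * h)), aux fun z => rnAct μ h z * rnAct μ g (h • z), ← e1, e3, e2]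
  simp only [mul_assoc]

/-- Vanishing is excluded by the chain rule for `g⁻¹ * g = 1`, whose derivative is 1. -/
lemma IsQuasiInvariant.ae_rnAct_ne [Countable G] (hq : IsQuasiInvariant G μ) :
    ∀ᵐ z ∂μ, ∀ g : G, rnAct μ g z ≠ 0 ∧ rnAct μ g z ≠ ∞ := by
  rw [ae_all_iff]
  intro g
  filter_upwards [hq.rnAct_mul g⁻¹ g, IsQuasiInvariant.rnAct_one (G := G) (μ := μ),
    Measure.rnDeriv_lt_top (μ.map (fun z : Z => g⁻¹ • z)) μ] with z h1 h2 h3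
  refine ⟨fun h => ?_, h3.ne⟩
  rw [inv_mul_cancel, h2, h, zero_mul] at h1
  exact one_ne_zero h1

lemma IsQuasiInvariant.ae_isCocyclePoint [Countable G] (hq : IsQuasiInvariant G μ) :
    ∀ᵐ z ∂μ, IsCocyclePoint G μ z := by
  have h1 : ∀ᵐ z ∂μ, ∀ g h : G, rnAct μ (g * h) z = rnAct μ h z * rnAct μ g (h • z) := by
    rw [ae_all_iff]; intro g; rw [ae_all_iff]; exact hq.rnAct_mul g
  have h2 : ∀ᵐ z ∂μ, ∀ h : G, ∀ g : G, rnAct μ g (h • z) ≠ 0 ∧ rnAct μ g (h • z) ≠ ∞ := by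
    rw [ae_all_iff]; exact fun h => (hq h).ae hq.ae_rnAct_ne
  filter_upwards [h1, h2, hq.ae_rnAct_ne (G := G)] with z h1 h2 h3 g h
  rw [logRN, h1, ENNReal.toReal_mul, Real.log_mul, add_comm]
  · rfl
  · exact ENNReal.toReal_ne_zero.2 (h3 h)
  · exact ENNReal.toReal_ne_zero.2 (h2 h g)

lemma IsQuasiInvariant.ae_exp_logRN [Countable G] (hq : IsQuasiInvariant G μ) :
    ∀ᵐ z ∂μ, ∀ g : G, rnAct μ g z = ENNReal.ofReal (Real.exp (logRN μ g z)) := by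
  filter_upwards [hq.ae_rnAct_ne (G := G)] with z hz g
  rw [logRN, Real.exp_log (ENNReal.toReal_pos (hz g).1 (hz g).2), ENNReal.ofReal_toReal (hz g).2]

end Cocycle

/-! ### Logarithmic ratios and their group structure -/

section LogRatio

variable {G : Type*} {Z : Type*} [Group G] [MeasurableSpace Z] [MulAction G Z]
  {μ : Measure Z}

/-- The points of `A` that `g` returns to `A` with logarithmic derivative `ε`-close to `a`. -/
def returnSet (μ : Measure Z) (A : Set Z) (g : G) (a ε : ℝ) : Set Z :=
  {z | z ∈ A ∧ g • z ∈ A ∧ |logRN μ g z - a| < ε}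

/-- The ratio set in logarithmic coordinates. -/
def IsLogRatio (G : Type*) {Z : Type*} [Group G] [MeasurableSpace Z] [MulAction G Z]
    (μ : Measure Z) (a : ℝ) : Prop :=
  ∀ A : Set Z, MeasurableSet A → 0 < μ A → ∀ ε : ℝ, 0 < ε →
    ∃ g : G, g ≠ 1 ∧ 0 < μ (returnSet μ A g a ε)

lemma returnSet_mono {A : Set Z} {g : G} {a ε b ε' : ℝ} (h : |a - b| + ε ≤ ε') :
    returnSet μ A g a ε ⊆ returnSet μ A g b ε' := by
  rintro z ⟨h1, h2, h3⟩
  refine ⟨h1, h2, ?_⟩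
  have := abs_sub_le (logRN μ g z) a b
  linarith

lemma isClosed_isLogRatio : IsClosed {a | IsLogRatio G μ a} := by
  rw [← closure_subset_iff_isClosed]
  intro a ha A hA hpos ε hε
  obtain ⟨b, hb, hab⟩ := Metric.mem_closure_iff.1 ha (ε / 2) (half_pos hε)
  obtain ⟨g, hg, hgp⟩ := hb A hA hpos (ε / 2) (half_pos hε)
  refine ⟨g, hg, hgp.trans_le (measure_mono (returnSet_mono ?_))⟩
  rw [dist_comm, Real.dist_eq] at hab
  linarith

lemma not_memRatioSetReal_of_neg [NeZero μ] {r : ℝ} (hr : r < 0) : ¬ MemRatioSetReal G μ r := by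
  intro h
  obtain ⟨A', -, -, hp, g, -, -, h2⟩ := h univ MeasurableSet.univ
    (pos_iff_ne_zero.2 (by simpa using NeZero.ne μ)) (-r / 2) (by linarith)
  obtain ⟨z, hz⟩ := nonempty_of_measure_ne_zero hp.ne'
  have h3 := (abs_le.1 (h2 z hz)).2
  have : 0 ≤ (rnAct μ g z).toReal := ENNReal.toReal_nonneg
  linarith

variable [MeasurableConstSMul G Z]

lemma measurableSet_returnSet {A : Set Z} (hA : MeasurableSet A) (g : G) (a ε : ℝ) :
    MeasurableSet (returnSet μ A g a ε) := by
  have h1 : MeasurableSet {z : Z | g • z ∈ A} := measurable_const_smul g hA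
  have h2 : Measurable fun z => |logRN μ g z - a| :=
    ((measurable_logRN g).sub_const a).abs
  exact hA.inter (h1.inter (measurableSet_lt h2 measurable_const))

variable [IsFiniteMeasure μ] [Countable G]

lemma memRatioSetReal_exp_iff (hq : IsQuasiInvariant G μ) (a : ℝ) :
    MemRatioSetReal G μ (Real.exp a) ↔ IsLogRatio G μ a := by
  constructor
  · intro h A hA hpos ε hε
    have hc := Real.continuousAt_log (Real.exp_pos a).ne'
    obtain ⟨δ, hδ, hd⟩ := Metric.continuousAt_iff.1 hc ε hε
    obtain ⟨A', hAA, -, hp, g, hg, h1, h2⟩ := h A hA hpos (δ / 2) (half_pos hδ)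
    refine ⟨g, hg, hp.trans_le (measure_mono fun z hz => ⟨hAA hz, h1 z hz, ?_⟩)⟩
    have := @hd (rnAct μ g z).toReal (by rw [Real.dist_eq]; linarith [h2 z hz])
    rwa [Real.log_exp, Real.dist_eq] at this
  · intro h A hA hpos ε hε
    obtain ⟨δ, hδ, hd⟩ := Metric.continuousAt_iff.1 (Real.continuous_exp.continuousAt (x := a)) ε hε
    obtain ⟨g, hg, hp⟩ := h A hA hpos δ hδ
    -- The ratio set demands a bound at every point of `A'`, so the null set where the derivative is
    -- 0 or ∞, and its logarithm a default value, is removed.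
    have hm : MeasurableSet {z | rnAct μ g z = ENNReal.ofReal (Real.exp (logRN μ g z))} :=
      measurableSet_eq_fun (measurable_rnAct g)
        (Real.measurable_exp.comp (measurable_logRN g)).ennreal_ofReal
    have hae : ∀ᵐ z ∂μ, z ∈ {z | rnAct μ g z = ENNReal.ofReal (Real.exp (logRN μ g z))} := by
      filter_upwards [hq.ae_exp_logRN] with z hz using hz g
    refine ⟨returnSet μ A g a δ ∩ {z | rnAct μ g z = ENNReal.ofReal (Real.exp (logRN μ g z))},
      fun z hz => hz.1.1, (measurableSet_returnSet hA g a δ).inter hm, ?_, g, hg,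
      fun z hz => hz.1.2.1, fun z hz => ?_⟩
    · rwa [measure_inter_conull' (by
        rw [← nonpos_iff_eq_zero]
        exact (measure_mono (fun z hz => hz.2)).trans_eq (ae_iff.1 hae))]
    · have h2 : rnAct μ g z = ENNReal.ofReal (Real.exp (logRN μ g z)) := hz.2
      rw [h2, ENNReal.toReal_ofReal (Real.exp_pos _).le, ← Real.dist_eq]
      exact (hd (by rw [Real.dist_eq]; exact hz.1.2.2)).le

lemma IsLogRatio.neg (hq : IsQuasiInvariant G μ) {a : ℝ} (ha : IsLogRatio G μ a) :
    IsLogRatio G μ (-a) := by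
  intro A hA hpos ε hε
  obtain ⟨g, hg, hp⟩ := ha A hA hpos ε hε
  refine ⟨g⁻¹, inv_ne_one.2 hg, ?_⟩
  rw [pos_iff_ne_zero] at hp ⊢
  intro h0
  apply hp
  refine measure_mono_null_ae ?_ (hq.preimage_null g h0)
  filter_upwards [hq.ae_isCocyclePoint (G := G)] with z hz hzS
  refine ⟨hzS.2.1, by simpa using hzS.1, ?_⟩
  rw [hz.inv, ← abs_neg, neg_sub_neg, neg_sub]
  exact hzS.2.2

lemma IsLogRatio.add_of_ne (hq : IsQuasiInvariant G μ) {a b : ℝ} (ha : IsLogRatio G μ a)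
    (hb : IsLogRatio G μ b) (hab : a + b ≠ 0) : IsLogRatio G μ (a + b) := by
  intro A hA hpos ε' hε'
  -- With tolerance at most |a + b|, the identity cannot realize a + b, because its logarithmic
  -- derivative is 0.
  set ε := min ε' |a + b| with hεd
  have hε : 0 < ε := lt_min hε' (abs_pos.2 hab)
  obtain ⟨g, -, hp⟩ := ha A hA hpos (ε / 2) (half_pos hε)
  set S := returnSet μ A g a (ε / 2)
  have hS : MeasurableSet S := measurableSet_returnSet hA _ _ _
  obtain ⟨h, -, hp'⟩ := hb ((fun z => g⁻¹ • z) ⁻¹' S) (measurable_const_smul g⁻¹ hS)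
    (hq.preimage_pos g⁻¹ hp) (ε / 2) (half_pos hε)
  have key : 0 < μ (returnSet μ A (h * g) (a + b) ε) := by
    have hp2 := hq.preimage_pos g hp'
    rw [pos_iff_ne_zero] at hp2 ⊢
    intro h0
    apply hp2
    refine measure_mono_null_ae ?_ h0
    filter_upwards [hq.ae_isCocyclePoint (G := G)] with z hz hzS
    obtain ⟨h1, h2, h3⟩ := hzS
    simp only [mem_preimage, inv_smul_smul] at h1 h2
    refine ⟨h1.1, ?_, ?_⟩
    · have := h2.2.1
      rwa [smul_inv_smul, ← mul_smul] at this
    · rw [hz]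
      have e := abs_add_le (logRN μ h (g • z) - b) (logRN μ g z - a)
      have e2 := h1.2.2
      have : logRN μ h (g • z) + logRN μ g z - (a + b)
        = logRN μ h (g • z) - b + (logRN μ g z - a) := by ring
      rw [this]
      linarith
  refine ⟨h * g, fun h1 => ?_, key.trans_le (measure_mono (returnSet_mono ?_))⟩
  · apply key.ne'
    rw [h1]
    refine measure_mono_null_ae (t := ∅) ?_ measure_empty
    filter_upwards [hq.ae_isCocyclePoint (G := G)] with z hz hzS
    have := hzS.2.2
    rw [hz.one, zero_sub, abs_neg] at this
    exact absurd this (not_lt.2 (min_le_right _ _))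
  · simp [hεd]

/-- Suppose no `g ≠ 1` returns a part of `A` with logarithmic derivative near 0. The sets `C g`,
returned with logarithmic derivative near `a`, cover `A` up to a null set. Their images `E g` lie in
`A` and are almost disjoint: over an overlap of `E g` and `E h`, the element `h⁻¹ * g` would return
points with logarithmic derivative near `a - a = 0`. Each `E g` has at least exp(a/2) times the
measure of `C g`, so exp(a/2) μ(A) ≤ μ(A), which is absurd. -/
lemma IsLogRatio.zero_of_pos (hq : IsQuasiInvariant G μ) {a : ℝ} (ha : IsLogRatio G μ a)
    (hpos : 0 < a) : IsLogRatio G μ 0 := by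
  by_contra hcon
  simp only [IsLogRatio, not_forall, not_exists, not_and, not_lt, nonpos_iff_eq_zero] at hcon
  obtain ⟨A, hA, hAp, ε, hε, hnull⟩ := hcon
  -- The bound ε/2 lets two errors add up to less than ε; the bound a/2 keeps the logarithmic
  -- derivative on `C g` above a/2.
  set δ := min (ε / 2) (a / 2) with hδd
  have hδ : 0 < δ := lt_min (half_pos hε) (half_pos hpos)
  set C : G → Set Z := fun g => returnSet μ A g a δ
  set E : G → Set Z := fun g => (fun z => g⁻¹ • z) ⁻¹' C g
  have hC : ∀ g, MeasurableSet (C g) := fun g => measurableSet_returnSet hA _ _ _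
  have hE : ∀ g, MeasurableSet (E g) := fun g => measurable_const_smul g⁻¹ (hC g)
  have hcover : μ A ≤ ∑' g, μ (C g) := by
    have h0 : μ (A \ ⋃ g, C g) = 0 := by
      by_contra h0
      obtain ⟨g, -, hg⟩ := ha _ (hA.diff (MeasurableSet.iUnion hC)) (pos_iff_ne_zero.2 h0) δ hδ
      obtain ⟨z, hz⟩ := nonempty_of_measure_ne_zero hg.ne'
      exact hz.1.2 (mem_iUnion.2 ⟨g, hz.1.1, hz.2.1.1, hz.2.2⟩)
    calc μ A ≤ μ ((⋃ g, C g) ∪ (A \ ⋃ g, C g)) := measure_mono (by simp)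
      _ ≤ μ (⋃ g, C g) + μ (A \ ⋃ g, C g) := measure_union_le _ _
      _ ≤ ∑' g, μ (C g) := by rw [h0, add_zero]; exact measure_iUnion_le _
  have hdisj : Pairwise (Function.onFun (AEDisjoint μ) E) := by
    intro g h hgh
    have hne : h⁻¹ * g ≠ 1 := fun e => hgh (inv_mul_eq_one.1 e).symm
    refine measure_mono_null_ae ?_ (hq.preimage_null g⁻¹ (hnull (h⁻¹ * g) hne))
    filter_upwards [(hq g⁻¹).ae (hq.ae_isCocyclePoint (G := G))] with w hw hwS
    obtain ⟨⟨h1, h2, h3⟩, ⟨h4, h5, h6⟩⟩ := hwS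
    refine ⟨h1, by simpa [mul_smul] using h4, ?_⟩
    have e := hw h (h⁻¹ * g)
    rw [mul_inv_cancel_left, mul_smul, smul_inv_smul] at e
    have d1 : δ ≤ ε / 2 := min_le_left _ _
    simp only at h3 h6 ⊢
    rw [abs_lt] at h3 h6 ⊢
    constructor <;> linarith
  have hEA : ∑' g, μ (E g) ≤ μ A := by
    rw [← measure_iUnion₀ hdisj (fun g => (hE g).nullMeasurableSet)]
    refine measure_mono (iUnion_subset fun g z hz => ?_)
    have := hz.2.1
    simpa using this
  have hscale : ∀ g, ENNReal.ofReal (Real.exp (a / 2)) * μ (C g) ≤ μ (E g) := by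
    intro g
    have e : μ (E g) = ∫⁻ z in C g, rnAct μ g z ∂μ := by
      rw [← withDensity_apply _ (hC g), ← hq.map_eq_withDensity,
        Measure.map_apply (measurable_const_smul _) (hC g)]
    rw [e, ← setLIntegral_const]
    refine setLIntegral_mono_ae' (hC g) ?_
    filter_upwards [hq.ae_exp_logRN (G := G)] with z hz hzC
    rw [hz g]
    refine ENNReal.ofReal_le_ofReal (Real.exp_le_exp.2 ?_)
    have h1 := (abs_lt.1 hzC.2.2).1
    have d1 : δ ≤ a / 2 := min_le_right _ _
    linarith
  have hfin : ENNReal.ofReal (Real.exp (a / 2)) * μ A ≤ 1 * μ A := by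
    rw [one_mul]
    calc _ ≤ ENNReal.ofReal (Real.exp (a / 2)) * ∑' g, μ (C g) := by gcongr
      _ = ∑' g, ENNReal.ofReal (Real.exp (a / 2)) * μ (C g) := ENNReal.tsum_mul_left.symm
      _ ≤ ∑' g, μ (E g) := ENNReal.tsum_le_tsum hscale
      _ ≤ μ A := hEA
  have := (ENNReal.mul_le_mul_iff_left hAp.ne' (measure_ne_top μ A)).1 hfin
  rw [ENNReal.ofReal_le_one] at this
  have h1 := Real.add_one_lt_exp (half_pos hpos).ne'
  linarith

/-- The logarithms of the ratio set form a subgroup of `ℝ`, as soon as it has an element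
other than `0`. -/
lemma IsLogRatio.zero (hq : IsQuasiInvariant G μ) {a : ℝ} (ha : IsLogRatio G μ a)
    (hne : a ≠ 0) : IsLogRatio G μ 0 := by
  rcases lt_or_gt_of_ne hne with h | h
  · exact (ha.neg hq).zero_of_pos hq (neg_pos.2 h)
  · exact ha.zero_of_pos hq h

lemma memRatioSetReal_zero (hq : IsQuasiInvariant G μ)
    (h : ∀ M : ℝ, ∃ a < M, IsLogRatio G μ a) : MemRatioSetReal G μ 0 := by
  intro A hA hpos ε hε
  obtain ⟨a, haM, ha⟩ := h (Real.log (ε / 2))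
  obtain ⟨A', h1, h2, h3, g, hg, h4, h5⟩ :=
    (memRatioSetReal_exp_iff hq a).2 ha A hA hpos (ε / 2) (half_pos hε)
  refine ⟨A', h1, h2, h3, g, hg, h4, fun z hz => ?_⟩
  have e := h5 z hz
  have e2 : Real.exp a < ε / 2 := by
    rw [← Real.exp_log (half_pos hε)]; exact Real.exp_lt_exp.2 haM
  have e3 := Real.exp_pos a
  rw [abs_le] at e ⊢
  constructor <;> linarith

lemma memRatioSetTop (hq : IsQuasiInvariant G μ)
    (h : ∀ M : ℝ, ∃ a > M, IsLogRatio G μ a) : MemRatioSetTop G μ := by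
  intro A hA hpos M hM
  obtain ⟨a, haM, ha⟩ := h (Real.log (M + 1))
  obtain ⟨A', h1, h2, h3, g, hg, h4, h5⟩ :=
    (memRatioSetReal_exp_iff hq a).2 ha A hA hpos (1 / 2) one_half_pos
  refine ⟨A', h1, h2, h3, g, h4, fun z hz => ?_⟩
  have e := (abs_le.1 (h5 z hz)).1
  have e2 : M + 1 < Real.exp a := by
    rw [← Real.exp_log (by linarith : 0 < M + 1)]; exact Real.exp_lt_exp.2 haM
  linarith

end LogRatio

/-! ### The cocycle of a product with a measure preserving action -/

section Product

variable {G : Type*} [Group G] {X : Type*} [MeasurableSpace X] [MulAction G X]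
  [MeasurableConstSMul G X] {Y : Type*} [MeasurableSpace Y] [MulAction G Y]
  [MeasurableConstSMul G Y] {ν : Measure X} {κ : Measure Y}

instance measurableConstSMul_prod : MeasurableConstSMul G (X × Y) where
  measurable_const_smul g :=
    ((measurable_const_smul g).comp measurable_fst).prodMk
      ((measurable_const_smul g).comp measurable_snd)

variable [IsFiniteMeasure ν] [IsFiniteMeasure κ] [SMulInvariantMeasure G Y κ]

lemma IsQuasiInvariant.map_smul_prod (hq : IsQuasiInvariant G ν) (g : G) :
    (ν.prod κ).map (fun p : X × Y => g⁻¹ • p) =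
      (ν.prod κ).withDensity fun p => rnAct ν g p.1 := by
  have h := Measure.map_prod_map ν κ
    (measurable_const_smul (g⁻¹ : G) : Measurable fun x : X => g⁻¹ • x)
    (measurable_const_smul (g⁻¹ : G) : Measurable fun y : Y => g⁻¹ • y)
  rw [(measurePreserving_smul g⁻¹ κ).map_eq, hq.map_eq_withDensity,
    prod_withDensity_left (measurable_rnAct g)] at h
  exact h.symm

lemma IsQuasiInvariant.prod (hq : IsQuasiInvariant G ν) : IsQuasiInvariant G (ν.prod κ) := by
  intro g
  refine ⟨measurable_const_smul g, ?_⟩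
  have h := hq.map_smul_prod (κ := κ) g⁻¹
  rw [inv_inv] at h
  rw [h]
  exact withDensity_absolutelyContinuous _ _

lemma IsQuasiInvariant.rnAct_prod (hq : IsQuasiInvariant G ν) (g : G) :
    ∀ᵐ p ∂ν.prod κ, rnAct (ν.prod κ) g p = rnAct ν g p.1 := by
  rw [rnAct, hq.map_smul_prod]
  exact Measure.rnDeriv_withDensity _ ((measurable_rnAct g).comp measurable_fst)

lemma IsQuasiInvariant.logRN_prod [Countable G] (hq : IsQuasiInvariant G ν) :
    ∀ᵐ p ∂ν.prod κ, ∀ g : G, logRN (ν.prod κ) g p = logRN ν g p.1 := by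
  rw [ae_all_iff]
  intro g
  filter_upwards [hq.rnAct_prod g] with p hp
  rw [logRN, hp, logRN]

end Product

/-! ### From one nontrivial stable ratio to the stable type -/

section StableRatio

universe u v

variable {G : Type u} [Group G] {X : Type v} [MeasurableSpace X] [MulAction G X]

/-- The stable ratio set in logarithmic coordinates. -/
def IsStableLogRatio (G : Type u) [Group G] {X : Type v} [MeasurableSpace X] [MulAction G X]
    (ν : Measure X) (a : ℝ) : Prop :=
  ∀ (Y : Type) [MeasurableSpace Y] [StandardBorelSpace Y] [MulAction G Y]
    [MeasurableConstSMul G Y] (κ : Measure Y) [IsProbabilityMeasure κ] [SMulInvariantMeasure G Y κ],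
    IsLogRatio G (ν.prod κ) a

variable {ν : Measure X}

lemma isClosed_isStableLogRatio : IsClosed {a | IsStableLogRatio G ν a} := by
  simp only [IsStableLogRatio, ofPred_forall]
  repeat refine isClosed_iInter fun _ => ?_
  exact isClosed_isLogRatio

variable [MeasurableConstSMul G X] [IsProbabilityMeasure ν] [Countable G]

/-- The stable logarithmic ratios as a subgroup of `ℝ`. -/
def stableLogRatios (hq : IsQuasiInvariant G ν) {a₀ : ℝ} (ha₀ : a₀ ≠ 0)
    (h₀ : IsStableLogRatio G ν a₀) : AddSubgroup ℝ where
  carrier := {a | IsStableLogRatio G ν a}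
  zero_mem' := fun Y _ _ _ _ κ _ _ => (h₀ Y κ).zero hq.prod ha₀
  add_mem' := by
    intro a b ha hb Y _ _ _ _ κ _ _
    -- The ratio 0 needs its own argument, since composing returns may yield the identity.
    by_cases hab : a + b = 0
    · rw [hab]
      exact (h₀ Y κ).zero hq.prod ha₀
    · exact (ha Y κ).add_of_ne hq.prod (hb Y κ) hab
  neg_mem' := fun ha Y _ _ _ _ κ _ _ => (ha Y κ).neg hq.prod

/-- The integer multiples of `a₀` are unbounded in both directions, so exponentials of stable
logarithmic ratios approach 0 and ∞. Negative numbers are excluded because derivatives are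
nonnegative. -/
lemma stableRatioSet_eq (hq : IsQuasiInvariant G ν) {a₀ : ℝ} (ha₀ : a₀ ≠ 0)
    (h₀ : IsStableLogRatio G ν a₀) :
    stableRatioSet G ν =
      {0, ⊤} ∪ (fun a : ℝ => (Real.exp a : EReal)) '' {a | IsStableLogRatio G ν a} := by
  set H := stableLogRatios hq ha₀ h₀
  have hmul : ∀ n : ℤ, IsStableLogRatio G ν (n * a₀) := fun n => by
    have : n • a₀ ∈ H := H.zsmul_mem h₀ n
    rwa [zsmul_eq_mul] at this
  have hpos : ∀ M : ℝ, ∃ a > M, IsStableLogRatio G ν a := by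
    intro M
    obtain ⟨n, hn⟩ := exists_nat_gt (M / |a₀|)
    rw [div_lt_iff₀ (abs_pos.2 ha₀)] at hn
    rcases abs_choice a₀ with h | h
    · exact ⟨_, by simpa [h] using hn, hmul n⟩
    · exact ⟨_, by simpa [h] using hn, hmul (-n)⟩
  have hneg : ∀ M : ℝ, ∃ a < M, IsStableLogRatio G ν a := by
    intro M
    obtain ⟨a, ha, haS⟩ := hpos (-M)
    exact ⟨-a, by linarith, H.neg_mem haS⟩
  ext r
  constructor
  · intro hr
    by_cases htop : r = ⊤
    · simp [htop]
    have hreal : ∀ (Y : Type) [MeasurableSpace Y] [StandardBorelSpace Y] [MulAction G Y]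
        [MeasurableConstSMul G Y] (κ : Measure Y) [IsProbabilityMeasure κ]
        [SMulInvariantMeasure G Y κ],
        ∃ s : ℝ, r = (s : EReal) ∧ MemRatioSetReal G (ν.prod κ) s := by
      intro Y _ _ _ _ κ _ _
      rcases hr Y κ with h | h
      · exact h
      · exact absurd h.1 htop
    -- The trivial action on a point supplies one `Y` from which to read off the real number.
    have : SMulInvariantMeasure G Unit (Measure.dirac ()) := ⟨fun _ _ _ => rfl⟩
    have : MeasurableConstSMul G Unit := ⟨fun _ => measurable_id⟩
    obtain ⟨s, rfl, hs⟩ := hreal Unit (Measure.dirac ())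
    rcases lt_trichotomy s 0 with h | h | h
    · exact absurd hs (not_memRatioSetReal_of_neg h)
    · simp [h]
    · refine Or.inr ⟨Real.log s, ?_, by simp [Real.exp_log h]⟩
      intro Y _ _ _ _ κ _ _
      obtain ⟨s', hs', h'⟩ := hreal Y κ
      rw [EReal.coe_eq_coe_iff] at hs'
      rw [← memRatioSetReal_exp_iff hq.prod, Real.exp_log h, hs']
      exact h'
  · rintro ((rfl | rfl) | ⟨a, ha, rfl⟩) Y _ _ _ _ κ _ _
    · refine Or.inl ⟨0, rfl, memRatioSetReal_zero hq.prod fun M => ?_⟩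
      obtain ⟨a, ha, haS⟩ := hneg M
      exact ⟨a, ha, haS Y κ⟩
    · refine Or.inr ⟨rfl, memRatioSetTop hq.prod fun M => ?_⟩
      obtain ⟨a, ha, haS⟩ := hpos M
      exact ⟨a, ha, haS Y κ⟩
    · exact Or.inl ⟨_, rfl, (memRatioSetReal_exp_iff hq.prod a).2 (ha Y κ)⟩

/-- A single nontrivial stable ratio determines a stable type `III_lam`. -/
theorem hasStableTypeIII_of_isStableLogRatio (hq : IsQuasiInvariant G ν) {a₀ : ℝ} (ha₀ : a₀ ≠ 0)
    (h₀ : IsStableLogRatio G ν a₀) :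
    (∃ lam : ℝ, 1 ≤ lam ∧ HasStableTypeIII G ν lam) ∧
      ¬ stableRatioSet G ν ⊆ {(0 : EReal), 1, ⊤} := by
  have hS := stableRatioSet_eq hq ha₀ h₀
  set H := stableLogRatios hq ha₀ h₀
  have hH : {a | IsStableLogRatio G ν a} = (H : Set ℝ) := rfl
  constructor
  · rcases H.dense_or_cyclic with hd | ⟨a, ha⟩
    · refine ⟨1, le_rfl, Or.inl ⟨rfl, ?_⟩⟩
      have huniv : {a | IsStableLogRatio G ν a} = univ := by
        rw [← isClosed_isStableLogRatio.closure_eq, hH, hd.closure_eq]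
      rw [hS, huniv]
      ext r
      constructor
      · rintro ((rfl | rfl) | ⟨a, -, rfl⟩)
        · simp
        · simp
        · exact ⟨EReal.coe_nonneg.2 (Real.exp_pos a).le, le_top⟩
      · rintro ⟨h0, -⟩
        induction r with
        | bot => simp at h0
        | top => simp
        | coe s =>
          rcases (EReal.coe_nonneg.1 h0).eq_or_lt with h | h
          · simp [← h]
          · exact Or.inr ⟨Real.log s, mem_univ _, by simp [Real.exp_log h]⟩
    · have hmem : ∀ x, IsStableLogRatio G ν x ↔ ∃ n : ℤ, n * a = x := by
        intro x
        have : IsStableLogRatio G ν x ↔ x ∈ H := Iff.rfl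
        rw [this, ha, AddSubgroup.mem_closure_singleton]
        simp
      have ha0 : a ≠ 0 := by
        rintro rfl
        obtain ⟨n, hn⟩ := (hmem a₀).1 h₀
        exact ha₀ (by simpa using hn.symm)
      have hmem' : ∀ x, IsStableLogRatio G ν x ↔ ∃ n : ℤ, n * |a| = x := by
        intro x
        rw [hmem]
        rcases abs_choice a with h | h
        · rw [h]
        · rw [h]
          constructor <;> rintro ⟨n, hn⟩ <;> exact ⟨-n, by simpa using hn⟩
      have hlam : 1 < Real.exp |a| := Real.one_lt_exp_iff.2 (abs_pos.2 ha0)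
      refine ⟨Real.exp |a|, hlam.le, Or.inr ⟨hlam, ?_⟩⟩
      rw [hS]
      congr 1
      ext r
      simp only [mem_image, mem_ofPred_eq, mem_range, hmem']
      constructor
      · rintro ⟨_, ⟨n, rfl⟩, rfl⟩
        exact ⟨n, by rw [mul_comm, Real.exp_mul, Real.rpow_intCast]⟩
      · rintro ⟨n, rfl⟩
        exact ⟨_, ⟨n, rfl⟩, by rw [mul_comm, Real.exp_mul, Real.rpow_intCast]⟩
  · intro hsub
    have hmem : (Real.exp a₀ : EReal) ∈ stableRatioSet G ν := by
      rw [hS]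
      exact Or.inr ⟨a₀, h₀, rfl⟩
    rcases hsub hmem with h | h | h
    · exact (Real.exp_pos a₀).ne' (by exact_mod_cast h)
    · have : Real.exp a₀ = 1 := by exact_mod_cast h
      exact ha₀ (Real.exp_eq_one_iff _ |>.1 this)
    · exact EReal.coe_ne_top _ h

end StableRatio

/-! ### Averaging against the density of an admissible family -/

section Transfer

variable {G : Type*} {X : Type*} [MeasurableSpace X] {ν : Measure X} {u : G → X → X → ℝ≥0}
  {S : Set X} {φ ψ : G → X × X → ℝ≥0∞}

/-- The integral of `φ` over `G × S × X` against the density `u`. -/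
noncomputable def transfer (ν : Measure X) (u : G → X → X → ℝ≥0) (S : Set X)
    (φ : G → X × X → ℝ≥0∞) : ℝ≥0∞ :=
  ∑' g, ∫⁻ p, φ g p ∂((ν.restrict S).prod ν).withDensity fun p => (u g p.1 p.2 : ℝ≥0∞)

lemma transfer_add (hφ : ∀ g, Measurable (φ g)) :
    transfer ν u S (fun g p => φ g p + ψ g p) = transfer ν u S φ + transfer ν u S ψ := by
  rw [transfer, transfer, transfer, ← ENNReal.tsum_add]
  exact tsum_congr fun g => lintegral_add_left (hφ g) _

lemma transfer_const_mul (hφ : ∀ g, Measurable (φ g)) (c : ℝ≥0∞) :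
    transfer ν u S (fun g p => c * φ g p) = c * transfer ν u S φ := by
  rw [transfer, transfer, ← ENNReal.tsum_mul_left]
  exact tsum_congr fun g => lintegral_const_mul _ (hφ g)

variable [IsFiniteMeasure ν]

lemma transfer_eq (hu : ∀ g, Measurable fun p : X × X => u g p.1 p.2) (hφ : ∀ g, Measurable (φ g)) :
    transfer ν u S φ = ∑' g, ∫⁻ b in S, ∫⁻ b', u g b b' * φ g (b, b') ∂ν ∂ν := by
  refine tsum_congr fun g => ?_
  rw [lintegral_withDensity_eq_lintegral_mul _ (hu g).coe_nnreal_ennreal (hφ g),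
    lintegral_prod _ ((hu g).coe_nnreal_ennreal.mul (hφ g)).aemeasurable]
  rfl

lemma transfer_mono_ae (hu : ∀ g, Measurable fun p : X × X => u g p.1 p.2) (hS : MeasurableSet S)
    (h : ∀ g, ∀ᵐ p ∂ν.prod ν, p.1 ∈ S → 0 < u g p.1 p.2 → φ g p ≤ ψ g p) :
    transfer ν u S φ ≤ transfer ν u S ψ := by
  refine ENNReal.tsum_le_tsum fun g => lintegral_mono_ae ?_
  rw [ae_withDensity_iff (hu g).coe_nnreal_ennreal]
  have e : (ν.restrict S).prod ν = (ν.prod ν).restrict (S ×ˢ univ) := by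
    rw [← Measure.prod_restrict, Measure.restrict_univ]
  rw [e, ae_restrict_iff' (hS.prod MeasurableSet.univ)]
  filter_upwards [h g] with p hp hpS hpu
  exact hp hpS.1 (by simpa [pos_iff_ne_zero] using hpu)

variable [Countable G]

lemma transfer_fst (hu : ∀ g, Measurable fun p : X × X => u g p.1 p.2)
    (h1 : ∀ b, ∑' g, ∫⁻ b', (u g b b' : ℝ≥0∞) ∂ν = 1) {f : X → ℝ≥0∞} (hf : Measurable f) :
    transfer ν u S (fun _ p => f p.1) = ∫⁻ b in S, f b ∂ν := by
  rw [transfer_eq (φ := fun _ p => f p.1) hu fun _ => hf.comp measurable_fst]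
  have hu' : ∀ g b, Measurable fun b' => (u g b b' : ℝ≥0∞) := fun g b =>
    ((hu g).comp measurable_prodMk_left).coe_nnreal_ennreal
  have e : ∀ g b, ∫⁻ b', u g b b' * f b ∂ν = (∫⁻ b', u g b b' ∂ν) * f b := fun g b =>
    lintegral_mul_const _ (hu' g b)
  simp only [e]
  rw [← lintegral_tsum]
  · simp only [ENNReal.tsum_mul_right, h1, one_mul]
  · intro g
    exact ((hu g).coe_nnreal_ennreal.lintegral_prod_right.mul hf).aemeasurable

end Transfer

/-! ### Period defects and their common zeros -/

section Defect

variable {G : Type*} {X : Type*} [Group G] [MeasurableSpace X] [MulAction G X] {ν : Measure X}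
  {Υ : ℕ → G → X → X → ℝ≥0} {Ω : ℕ → Set X} {D D' : X → ℝ → ℝ≥0∞}

/-- `D x s` measures to which extent `s` fails to be a period at `x`: it is Lipschitz in `s`, its
zero set is invariant, and it is asymptotically small at the increments of the logarithmic
Radon-Nikodym cocycle, on average with respect to `Υ n` on `Ω n`. -/
structure IsPeriodDefect (ν : Measure X) (Υ : ℕ → G → X → X → ℝ≥0) (Ω : ℕ → Set X)
    (D : X → ℝ → ℝ≥0∞) : Prop where
  measurable : Measurable (Function.uncurry D)
  lipschitz : ∃ L : ℝ≥0, ∀ x s s', D x s ≤ D x s' + L * ENNReal.ofReal |s - s'|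
  compare : ∀ g : G, ∀ᵐ x ∂ν, ∃ c : ℝ≥0, ∀ s, D x s ≤ c * D (g • x) s
  tendsto : Tendsto (fun n => transfer ν (Υ n) (Ω n)
    fun g p => D p.1 |logRN ν g⁻¹ p.1 - logRN ν g⁻¹ p.2|) atTop (𝓝 0)

lemma measurable_logRN_sub (g : G) :
    Measurable fun p : X × X => |logRN ν g p.1 - logRN ν g p.2| :=
  (((measurable_logRN g).comp measurable_fst).sub ((measurable_logRN g).comp measurable_snd)).abs

lemma IsPeriodDefect.measurable_increment (hD : IsPeriodDefect ν Υ Ω D) (g : G) :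
    Measurable fun p : X × X => D p.1 |logRN ν g⁻¹ p.1 - logRN ν g⁻¹ p.2| :=
  hD.measurable.comp (measurable_fst.prodMk (measurable_logRN_sub g⁻¹))

lemma IsPeriodDefect.zero : IsPeriodDefect ν Υ Ω (fun _ _ => 0) where
  measurable := measurable_const
  lipschitz := ⟨0, by simp⟩
  compare := fun _ => ae_of_all _ fun _ => ⟨0, by simp⟩
  tendsto := by simp [transfer]

lemma IsPeriodDefect.add (hD : IsPeriodDefect ν Υ Ω D)
    (hD' : IsPeriodDefect ν Υ Ω D') : IsPeriodDefect ν Υ Ω (fun x s => D x s + D' x s) where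
  measurable := hD.measurable.add hD'.measurable
  lipschitz := by
    obtain ⟨L, hL⟩ := hD.lipschitz
    obtain ⟨L', hL'⟩ := hD'.lipschitz
    refine ⟨L + L', fun x s s' => (add_le_add (hL x s s') (hL' x s s')).trans_eq ?_⟩
    push_cast
    ring
  compare := by
    intro g
    filter_upwards [hD.compare g, hD'.compare g] with x ⟨c, hc⟩ ⟨c', hc'⟩
    refine ⟨max c c', fun s => (add_le_add (hc s) (hc' s)).trans ?_⟩
    rw [mul_add]
    gcongr
    · exact le_max_left _ _
    · exact le_max_right _ _
  tendsto := by
    have := hD.tendsto.add hD'.tendsto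
    rw [add_zero] at this
    refine this.congr fun n => ?_
    exact (transfer_add fun g => hD.measurable_increment g).symm

lemma IsPeriodDefect.finset_sum {ι : Type*} (t : Finset ι)
    {E : ι → X → ℝ → ℝ≥0∞} (h : ∀ i ∈ t, IsPeriodDefect ν Υ Ω (E i)) :
    IsPeriodDefect ν Υ Ω (fun x s => ∑ i ∈ t, E i x s) := by
  classical
  induction t using Finset.induction_on with
  | empty => simpa using IsPeriodDefect.zero
  | insert i t hi ih =>
    simp only [Finset.sum_insert hi]
    exact (h i (Finset.mem_insert_self i t)).add
      (ih fun j hj => h j (Finset.mem_insert_of_mem hj))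

lemma eq_zero_of_forall_le_mul_inv {a : ℝ≥0∞} {L : ℝ≥0}
    (h : ∀ k : ℕ, a ≤ L * ENNReal.ofReal (1 / (k + 1))) : a = 0 := by
  have h1 : Tendsto (fun k : ℕ => (L : ℝ≥0∞) * ENNReal.ofReal (1 / ((k : ℝ) + 1))) atTop
      (𝓝 (L * ENNReal.ofReal 0)) :=
    ENNReal.Tendsto.const_mul (ENNReal.tendsto_ofReal tendsto_one_div_add_atTop_nhds_zero_nat)
      (Or.inr ENNReal.coe_ne_top)
  have := ge_of_tendsto' h1 h
  simpa using this

/-- A limit of zeros is approached by a sequence, so only countably many null sets are discarded,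
and the Lipschitz bound passes to the limit. -/
lemma IsPeriodDefect.isClosed_zeros (hD : IsPeriodDefect ν Υ Ω D) :
    IsClosed {s | ∀ᵐ x ∂ν, D x s = 0} := by
  obtain ⟨L, hL⟩ := hD.lipschitz
  rw [← closure_subset_iff_isClosed]
  intro s hs
  have : ∀ k : ℕ, ∃ s', (∀ᵐ x ∂ν, D x s' = 0) ∧ |s - s'| < 1 / (k + 1) := fun k =>
    Metric.mem_closure_iff.1 hs _ Nat.one_div_pos_of_nat
  choose q hq hqs using this
  filter_upwards [ae_all_iff.2 hq] with x hx
  refine eq_zero_of_forall_le_mul_inv (L := L) fun k => ?_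
  have := hL x s (q k)
  rw [hx, zero_add] at this
  exact this.trans (by gcongr; exact (hqs k).le)

/-- By the Lipschitz bound the infimum over an open set is already an infimum over its rational
points. -/
lemma IsPeriodDefect.measurable_iInf (hD : IsPeriodDefect ν Υ Ω D) {J : Set ℝ} (hJ : IsOpen J) :
    Measurable fun x => ⨅ s ∈ J, D x s := by
  obtain ⟨L, hL⟩ := hD.lipschitz
  have e : ∀ x, ⨅ s ∈ J, D x s = ⨅ q : ℚ, ⨅ _ : (q : ℝ) ∈ J, D x q := by
    intro x
    refine le_antisymm (le_iInf₂ fun q hq => iInf₂_le (q : ℝ) hq) (le_iInf₂ fun s hs => ?_)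
    refine ENNReal.le_of_forall_pos_le_add fun ε hε _ => ?_
    have hδ : 0 < (ε : ℝ) / (L + 1) := by positivity
    obtain ⟨q, hq, hqs⟩ := Rat.denseRange_cast.exists_mem_open
      (hJ.inter (Metric.isOpen_ball (x := s) (ε := (ε : ℝ) / (L + 1))))
      ⟨s, hs, Metric.mem_ball_self hδ⟩
    refine (iInf₂_le q hq).trans ((hL x q s).trans ?_)
    gcongr
    rw [Metric.mem_ball, Real.dist_eq] at hqs
    calc (L : ℝ≥0∞) * ENNReal.ofReal |(q : ℝ) - s|
        ≤ ENNReal.ofReal (L + 1) * ENNReal.ofReal ((ε : ℝ) / (L + 1)) := by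
          gcongr
          rw [ENNReal.ofReal_add (by positivity) zero_le_one, ENNReal.ofReal_coe_nnreal]
          exact le_self_add
      _ = ε := by
          rw [← ENNReal.ofReal_mul (by positivity), mul_div_cancel₀ _ (by positivity),
            ENNReal.ofReal_coe_nnreal]
  simp only [e]
  refine Measurable.iInf fun q => Measurable.iInf fun _ => ?_
  exact hD.measurable.comp (measurable_id.prodMk measurable_const)

/-- Near a parameter which is not a common zero, the defect is almost everywhere bounded away from
zero (ergodicity). -/
lemma IsPeriodDefect.exists_nhds_pos (hD : IsPeriodDefect ν Υ Ω D) (he : IsErgodicAction G ν)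
    {s : ℝ} (hs : ¬ ∀ᵐ x ∂ν, D x s = 0) :
    ∃ J ∈ 𝓝 s, ∀ᵐ x ∂ν, 0 < ⨅ s' ∈ J, D x s' := by
  by_contra hcon
  apply hs
  obtain ⟨L, hL⟩ := hD.lipschitz
  have hk : ∀ k : ℕ, ∀ᵐ x ∂ν, ⨅ s' ∈ Metric.ball s (1 / ((k : ℝ) + 1)), D x s' = 0 := by
    intro k
    set J := Metric.ball s (1 / ((k : ℝ) + 1))
    set m : X → ℝ≥0∞ := fun x => ⨅ s' ∈ J, D x s'
    have hm : Measurable m := hD.measurable_iInf Metric.isOpen_ball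
    have hmS : MeasurableSet {x | m x = 0} := hm (measurableSet_singleton 0)
    have hcomp : ∀ g : G, ∀ᵐ x ∂ν, m (g • x) = 0 → m x = 0 := by
      intro g
      filter_upwards [hD.compare g] with x ⟨c, hc⟩ h0
      -- The comparison constant does not depend on the parameter, so it passes to infima. It is
      -- replaced by c + 1 because pulling a factor out of the infimum needs it nonzero.
      have : m x ≤ (c + 1) * m (g • x) := by
        simp only [m, ENNReal.mul_iInf_of_ne (a := (c : ℝ≥0∞) + 1) (by simp)
          (ENNReal.add_ne_top.2 ⟨ENNReal.coe_ne_top, ENNReal.one_ne_top⟩)]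
        refine le_iInf₂ fun s' hs' => (iInf₂_le s' hs').trans ((hc s').trans ?_)
        gcongr
        exact le_self_add
      simpa [h0] using this
    have hinv : ∀ g : G, (fun x : X => g • x) ⁻¹' {x | m x = 0} =ᵐ[ν] {x | m x = 0} := by
      intro g
      filter_upwards [hcomp g, (he.quasiInvariant g).ae (hcomp g⁻¹)] with x h1 h2
      rw [inv_smul_smul] at h2
      exact propext ⟨h1, h2⟩
    rcases eventuallyConst_set.1 (he.ae_const _ hmS hinv) with h | h
    · exact h
    -- By ergodicity the infimum over the ball vanishes almost everywhere or is positive almost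
    -- everywhere; the second case would give the neighbourhood assumed not to exist.
    · refine absurd ⟨J, Metric.ball_mem_nhds s Nat.one_div_pos_of_nat, ?_⟩ hcon
      filter_upwards [h] with x hx using pos_iff_ne_zero.2 hx
  filter_upwards [ae_all_iff.2 hk] with x hx
  refine eq_zero_of_forall_le_mul_inv (L := L) fun k => ?_
  have h1 : D x s ≤ (⨅ s' ∈ Metric.ball s (1 / ((k : ℝ) + 1)), D x s')
      + L * ENNReal.ofReal (1 / (k + 1)) := by
    rw [ENNReal.iInf_add]
    refine le_iInf fun s' => ?_
    rw [ENNReal.iInf_add]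
    refine le_iInf fun hs' => (hL x s s').trans ?_
    rw [Metric.mem_ball, dist_comm, Real.dist_eq] at hs'
    gcongr
  rwa [hx, zero_add] at h1

variable [IsProbabilityMeasure ν]

/-- A defect has a common zero in every compact interval containing, for large `n`, the cocycle
increments. -/
lemma IsPeriodDefect.exists_common_zero [Countable G] (hD : IsPeriodDefect ν Υ Ω D)
    (he : IsErgodicAction G ν)
    (hΥ : ∀ n g, Measurable fun p : X × X => Υ n g p.1 p.2) (hΩ : ∀ n, MeasurableSet (Ω n))
    (hΩm : ∀ n, 3 / 4 ≤ ν (Ω n))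
    (h1 : ∀ n, 0 < n → ∀ b, ∑' g, ∫⁻ b', (Υ n g b b' : ℝ≥0∞) ∂ν = 1) {a c : ℝ}
    (hK : ∀ᶠ n in atTop, ∀ g : G, ∀ᵐ p ∂ν.prod ν, p.1 ∈ Ω n → 0 < Υ n g p.1 p.2 →
      |logRN ν g⁻¹ p.1 - logRN ν g⁻¹ p.2| ∈ Ioo a c) :
    ∃ s ∈ Icc a c, ∀ᵐ x ∂ν, D x s = 0 := by
  by_contra! hcon
  have hpos : ∀ᵐ x ∂ν, 0 < ⨅ s ∈ Icc a c, D x s := by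
    -- Almost everywhere positivity of the infimum passes to subsets and to finite unions, so the
    -- local statement extends to the compact interval.
    refine (isCompact_Icc (a := a) (b := c)).induction_on
      (p := fun J => ∀ᵐ x ∂ν, 0 < ⨅ s ∈ J, D x s) (by simp) ?_ ?_ ?_
    · intro s t hst ht
      filter_upwards [ht] with x hx
      exact hx.trans_le (biInf_mono fun _ h => hst h)
    · intro s t hs ht
      filter_upwards [hs, ht] with x hx hx'
      rw [iInf_union]
      exact lt_min hx hx'
    · intro s hs
      obtain ⟨J, hJ, h⟩ := hD.exists_nhds_pos he (s := s) (by simpa using hcon s hs)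
      exact ⟨J, mem_nhdsWithin_of_mem_nhds hJ, h⟩
  set m : X → ℝ≥0∞ := fun x => ⨅ s ∈ Ioo a c, D x s with hmd
  have hm : Measurable m := hD.measurable_iInf isOpen_Ioo
  have hmpos : ∀ᵐ x ∂ν, 0 < m x := by
    filter_upwards [hpos] with x hx
    exact hx.trans_le (biInf_mono fun _ h => Ioo_subset_Icc_self h)
  -- By the normalization this integral is the transfer of `m`, which is at most that of the defect
  -- at the increments.
  have hlim : Tendsto (fun n => ∫⁻ x in Ω n, m x ∂ν) atTop (𝓝 0) := by
    refine tendsto_of_tendsto_of_tendsto_of_le_of_le' tendsto_const_nhds hD.tendsto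
      (Eventually.of_forall fun _ => zero_le) ?_
    filter_upwards [hK, eventually_gt_atTop 0] with n hn hn0
    rw [← transfer_fst (hΥ n) (h1 n hn0) hm]
    refine transfer_mono_ae (hΥ n) (hΩ n) fun g => ?_
    filter_upwards [hn g] with p hp hpΩ hpΥ
    exact iInf₂_le _ (hp hpΩ hpΥ)
  -- A set of measure above 1/2 meets every `Ω n`, of measure at least 3/4, in measure at least 1/4;
  -- this keeps the integrals away from 0.
  obtain ⟨k, hk⟩ : ∃ k : ℕ, 1 / 2 < ν {x | (((k : ℝ≥0∞) + 1)⁻¹) ≤ m x} := by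
    have hmono : Monotone fun k : ℕ => {x | (((k : ℝ≥0∞) + 1)⁻¹) ≤ m x} := by
      intro i j hij x hx
      have hx' : ((i : ℝ≥0∞) + 1)⁻¹ ≤ m x := hx
      exact le_trans (by gcongr) hx'
    have hU : ν (⋃ k : ℕ, {x | (((k : ℝ≥0∞) + 1)⁻¹) ≤ m x}) = 1 := by
      refine (mem_ae_iff_prob_eq_one
        (MeasurableSet.iUnion fun k => measurableSet_le measurable_const hm)).1 ?_
      filter_upwards [hmpos] with x hx
      obtain ⟨k, hk⟩ := ENNReal.exists_inv_nat_lt hx.ne'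
      refine mem_iUnion.2 ⟨k, le_trans ?_ hk.le⟩
      gcongr
      exact le_self_add
    rw [hmono.measure_iUnion] at hU
    refine lt_iSup_iff.1 ?_
    rw [hU]
    simp
  set E := {x | (((k : ℝ≥0∞) + 1)⁻¹) ≤ m x}
  have hE : MeasurableSet E := measurableSet_le measurable_const hm
  have hlow : ∀ n, ((k : ℝ≥0∞) + 1)⁻¹ * (1 / 4) ≤ ∫⁻ x in Ω n, m x ∂ν := by
    intro n
    have hq : 1 / 4 ≤ ν (E ∩ Ω n) := by
      have h2 := measure_union_add_inter (μ := ν) E (hΩ n)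
      have h3 : ν (E ∪ Ω n) ≤ 1 := prob_le_one
      have h4 : (1 : ℝ≥0∞) + 1 / 4 ≤ 1 + ν (E ∩ Ω n) := by
        calc (1 : ℝ≥0∞) + 1 / 4 = 1 / 2 + 3 / 4 := by
              rw [← ENNReal.toReal_eq_toReal_iff' (by finiteness) (by finiteness)]
              rw [ENNReal.toReal_add, ENNReal.toReal_add] <;> norm_num [ENNReal.div_eq_top]
          _ ≤ ν E + ν (Ω n) := add_le_add hk.le (hΩm n)
          _ = ν (E ∪ Ω n) + ν (E ∩ Ω n) := h2.symm
          _ ≤ 1 + ν (E ∩ Ω n) := by gcongr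
      exact (ENNReal.add_le_add_iff_left ENNReal.one_ne_top).1 h4
    calc ((k : ℝ≥0∞) + 1)⁻¹ * (1 / 4) ≤ ((k : ℝ≥0∞) + 1)⁻¹ * ν (E ∩ Ω n) := by gcongr
      _ = ∫⁻ _ in E ∩ Ω n, ((k : ℝ≥0∞) + 1)⁻¹ ∂ν := (setLIntegral_const _ _).symm
      _ ≤ ∫⁻ x in E ∩ Ω n, m x ∂ν :=
        setLIntegral_mono' (hE.inter (hΩ n)) fun x hx => hx.1
      _ ≤ ∫⁻ x in Ω n, m x ∂ν := lintegral_mono_set inter_subset_right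
  have h0 := ge_of_tendsto' hlim hlow
  simp [ENNReal.add_eq_top] at h0

/-- All defects have a common zero. -/
lemma exists_forall_isPeriodDefect_zero [Countable G] (he : IsErgodicAction G ν)
    (hΥ : ∀ n g, Measurable fun p : X × X => Υ n g p.1 p.2) (hΩ : ∀ n, MeasurableSet (Ω n))
    (hΩm : ∀ n, 3 / 4 ≤ ν (Ω n))
    (h1 : ∀ n, 0 < n → ∀ b, ∑' g, ∫⁻ b', (Υ n g b b' : ℝ≥0∞) ∂ν = 1) {a c : ℝ}
    (hK : ∀ᶠ n in atTop, ∀ g : G, ∀ᵐ p ∂ν.prod ν, p.1 ∈ Ω n → 0 < Υ n g p.1 p.2 →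
      |logRN ν g⁻¹ p.1 - logRN ν g⁻¹ p.2| ∈ Ioo a c) :
    ∃ s ∈ Icc a c, ∀ D, IsPeriodDefect ν Υ Ω D → ∀ᵐ x ∂ν, D x s = 0 := by
  -- Finite intersection property: a zero of a finite sum of defects is a zero of each summand.
  obtain ⟨s, hs, hsD⟩ := (isCompact_Icc (a := a) (b := c)).inter_iInter_nonempty
    (fun D : {D // IsPeriodDefect ν Υ Ω D} => {s | ∀ᵐ x ∂ν, D.1 x s = 0})
    (fun D => D.2.isClosed_zeros) (fun t => by
      obtain ⟨s, hs, h⟩ := (IsPeriodDefect.finset_sum t fun D _ => D.2).exists_common_zero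
        he hΥ hΩ hΩm h1 hK
      refine ⟨s, hs, mem_iInter₂.2 fun D hD => ?_⟩
      filter_upwards [h] with x hx
      exact Finset.sum_eq_zero_iff.1 hx D hD)
  exact ⟨s, hs, fun D hD => mem_iInter.1 hsD ⟨D, hD⟩⟩

end Defect

/-! ### Approximation by functions uniformly continuous in x -/

section Approximation

/-- Integrable functions on `X × W` are approximated in `L¹` by functions which are continuous in
the first variable, uniformly in the second. -/
lemma exists_uniform_approx {X : Type*} [MetricSpace X] [CompactSpace X] [MeasurableSpace X]
    [BorelSpace X] {W : Type*} [MeasurableSpace W] [StandardBorelSpace W] {ν : Measure X}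
    [IsFiniteMeasure ν] {ω : Measure W} [IsFiniteMeasure ω] {f : X × W → ℝ}
    (hf : Integrable f (ν.prod ω)) {ε : ℝ≥0∞} (hε : ε ≠ 0) :
    ∃ u : X × W → ℝ, Measurable u ∧ ∫⁻ p, ‖f p - u p‖ₑ ∂ν.prod ω ≤ ε ∧
      ∀ η : ℝ, 0 < η → ∃ δ : ℝ, 0 < δ ∧
        ∀ x x' w, dist x x' < δ → dist (u (x, w)) (u (x', w)) < η := by
  -- Once `W` is embedded in ℝ, the function lives on the locally compact space X × ℝ, where
  -- compactly supported continuous functions are L¹-dense and uniformly continuous.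
  obtain ⟨e, he⟩ := exists_measurableEmbedding_real W
  have hE : MeasurableEmbedding (Prod.map id e : X × W → X × ℝ) := MeasurableEmbedding.id.prodMap he
  set E : X × W → X × ℝ := Prod.map id e
  have hext : Function.extend E f 0 ∘ E = f := Function.extend_comp hE.injective f 0
  have hf' : Integrable (Function.extend E f 0) ((ν.prod ω).map E) := by
    rw [hE.integrable_map_iff, hext]
    exact hf
  obtain ⟨g, hgc, hg, hgcont, -⟩ := hf'.exists_hasCompactSupport_lintegral_sub_le hε
  refine ⟨g ∘ E, hgcont.measurable.comp hE.measurable, ?_, fun η hη => ?_⟩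
  · rw [hE.lintegral_map] at hg
    refine le_of_eq_of_le (lintegral_congr fun p => ?_) hg
    rw [← congrFun hext p]
    rfl
  · obtain ⟨δ, hδ, h⟩ := Metric.uniformContinuous_iff.1
      (hgc.uniformContinuous_of_continuous hgcont) η hη
    refine ⟨δ, hδ, fun x x' w hx => h ?_⟩
    simpa [E, Prod.dist_eq, hδ] using hx

end Approximation

/-! ### Transfer bounds for the four base points -/

section Transfer

variable {G : Type*} {X : Type*} [Countable G] [MeasurableSpace X] {ν : Measure X}
  {u : G → X → X → ℝ≥0} {S : Set X} {f : X → ℝ≥0∞} {C : ℝ≥0∞}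

lemma tsum_lintegral_mul_le {ρ : Measure X} [SFinite ρ] {k : G → X → X → ℝ≥0∞}
    (hk : ∀ g, Measurable fun p : X × X => k g p.1 p.2)
    (h : ∀ᵐ y ∂ν, ∫⁻ x, ∑' g, k g y x ∂ρ ≤ C) (hf : Measurable f) :
    ∑' g, ∫⁻ y, (∫⁻ x, k g y x ∂ρ) * f y ∂ν ≤ C * ∫⁻ x, f x ∂ν := by
  have hk' : ∀ g y, Measurable (k g y) := fun g y => (hk g).comp measurable_prodMk_left
  have hm : ∀ g, Measurable fun y => (∫⁻ x, k g y x ∂ρ) * f y := fun g =>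
    (hk g).lintegral_prod_right'.mul hf
  calc ∑' g, ∫⁻ y, (∫⁻ x, k g y x ∂ρ) * f y ∂ν
      = ∫⁻ y, (∫⁻ x, ∑' g, k g y x ∂ρ) * f y ∂ν := by
        rw [← lintegral_tsum fun g => (hm g).aemeasurable]
        refine lintegral_congr fun y => ?_
        rw [ENNReal.tsum_mul_right, lintegral_tsum fun g => (hk' g y).aemeasurable]
    _ ≤ ∫⁻ y, C * f y ∂ν := by
        refine lintegral_mono_ae ?_
        filter_upwards [h] with y hy
        gcongr
    _ = C * ∫⁻ x, f x ∂ν := lintegral_const_mul _ hf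

variable [IsFiniteMeasure ν]

lemma transfer_snd_le (hu : ∀ g, Measurable fun p : X × X => u g p.1 p.2)
    (h : ∀ᵐ b' ∂ν, ∫⁻ b in S, ∑' g, (u g b b' : ℝ≥0∞) ∂ν ≤ C) (hf : Measurable f) :
    transfer ν u S (fun _ p => f p.2) ≤ C * ∫⁻ x, f x ∂ν := by
  have hu' : ∀ g, Measurable fun p : X × X => (u g p.1 p.2 : ℝ≥0∞) :=
    fun g => (hu g).coe_nnreal_ennreal
  rw [transfer_eq (φ := fun _ p => f p.2) hu fun _ => hf.comp measurable_snd]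
  calc ∑' g, ∫⁻ b in S, ∫⁻ b', u g b b' * f b' ∂ν ∂ν
      = ∑' g, ∫⁻ b', (∫⁻ b in S, u g b b' ∂ν) * f b' ∂ν := by
        refine tsum_congr fun g => ?_
        rw [lintegral_lintegral_swap ((hu' g).mul (hf.comp measurable_snd)).aemeasurable]
        refine lintegral_congr fun b' => lintegral_mul_const _ ?_
        exact (hu' g).comp measurable_prodMk_right
    _ ≤ C * ∫⁻ x, f x ∂ν :=
        tsum_lintegral_mul_le (k := fun g b' b => (u g b b' : ℝ≥0∞))
          (fun g => (hu' g).comp measurable_swap) h hf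

variable [Group G] [MulAction G X] [MeasurableConstSMul G X]

/-- Substituting `g • b'` for `b'` removes the translate from `f` and produces exactly the kernel
bounded in `h`. -/
lemma transfer_inv_smul_snd_le (hq : IsQuasiInvariant G ν)
    (hu : ∀ g, Measurable fun p : X × X => u g p.1 p.2)
    (h : ∀ᵐ b' ∂ν, ∫⁻ b in S, ∑' g, (u g b (g • b') : ℝ≥0∞) * rnAct ν g b' ∂ν ≤ C)
    (hf : Measurable f) :
    transfer ν u S (fun g p => f (g⁻¹ • p.2)) ≤ C * ∫⁻ x, f x ∂ν := by
  have hs : ∀ g : G, Measurable fun p : X × X => (p.1, g • p.2) := fun g =>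
    measurable_fst.prodMk ((measurable_const_smul g).comp measurable_snd)
  have hu' : ∀ g, Measurable fun p : X × X => (u g p.1 (g • p.2) : ℝ≥0∞) * rnAct ν g p.2 :=
    fun g => ((hu g).comp (hs g)).coe_nnreal_ennreal.mul ((measurable_rnAct g).comp measurable_snd)
  rw [transfer_eq (φ := fun g p => f (g⁻¹ • p.2)) hu fun g =>
    hf.comp ((measurable_const_smul _).comp measurable_snd)]
  calc ∑' g, ∫⁻ b in S, ∫⁻ b', u g b b' * f (g⁻¹ • b') ∂ν ∂ν
      = ∑' g, ∫⁻ b in S, ∫⁻ b', (u g b (g • b') * rnAct ν g b') * f b' ∂ν ∂ν := by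
        refine tsum_congr fun g => lintegral_congr fun b => ?_
        have hm : Measurable fun b' => (u g b (g • b') : ℝ≥0∞) * f b' :=
          (((hu g).comp (hs g)).comp measurable_prodMk_left).coe_nnreal_ennreal.mul hf
        have := hq.lintegral_inv_smul g hm
        simp only [smul_inv_smul] at this
        rw [this]
        refine lintegral_congr fun b' => ?_
        ring
    _ = ∑' g, ∫⁻ b', (∫⁻ b in S, u g b (g • b') * rnAct ν g b' ∂ν) * f b' ∂ν := by
        refine tsum_congr fun g => ?_
        rw [lintegral_lintegral_swap ((hu' g).mul (hf.comp measurable_snd)).aemeasurable]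
        refine lintegral_congr fun b' => lintegral_mul_const _ ?_
        exact (hu' g).comp measurable_prodMk_right
    _ ≤ C * ∫⁻ x, f x ∂ν :=
        tsum_lintegral_mul_le (k := fun g b' b => (u g b (g • b') : ℝ≥0∞) * rnAct ν g b')
          (fun g => (hu' g).comp measurable_swap) h hf

/-- Here the substitution is in the first variable, so the restriction to `S` must first become an
indicator, then evaluated at `g • b`. -/
lemma transfer_inv_smul_fst_le (hq : IsQuasiInvariant G ν) (hS : MeasurableSet S)
    (hu : ∀ g, Measurable fun p : X × X => u g p.1 p.2)
    (h : ∀ᵐ b ∂ν, ∫⁻ b', ∑' g : G,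
      S.indicator (fun x => (u g x b' : ℝ≥0∞)) (g • b) * rnAct ν g b ∂ν ≤ C)
    (hf : Measurable f) :
    transfer ν u S (fun g p => f (g⁻¹ • p.1)) ≤ C * ∫⁻ x, f x ∂ν := by
  have hi : ∀ g, Measurable fun p : X × X => S.indicator (fun x => (u g x p.2 : ℝ≥0∞)) p.1 := by
    intro g
    have : (fun p : X × X => S.indicator (fun x => (u g x p.2 : ℝ≥0∞)) p.1) =
        (Prod.fst ⁻¹' S).indicator fun p => (u g p.1 p.2 : ℝ≥0∞) := by
      ext p
      by_cases hp : p.1 ∈ S <;> simp [hp]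
    rw [this]
    exact (hu g).coe_nnreal_ennreal.indicator (measurable_fst hS)
  have hs : ∀ g : G, Measurable fun p : X × X => (g • p.1, p.2) := fun g =>
    ((measurable_const_smul g).comp measurable_fst).prodMk measurable_snd
  have hu' : ∀ g : G, Measurable fun p : X × X =>
      S.indicator (fun x => (u g x p.2 : ℝ≥0∞)) (g • p.1) * rnAct ν g p.1 :=
    fun g => ((hi g).comp (hs g)).mul ((measurable_rnAct g).comp measurable_fst)
  rw [transfer_eq (φ := fun g p => f (g⁻¹ • p.1)) hu fun g =>
    hf.comp ((measurable_const_smul _).comp measurable_fst)]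
  calc ∑' g, ∫⁻ b in S, ∫⁻ b', u g b b' * f (g⁻¹ • b) ∂ν ∂ν
      = ∑' g, ∫⁻ b, (∫⁻ b', S.indicator (fun x => (u g x b' : ℝ≥0∞)) b ∂ν) * f (g⁻¹ • b) ∂ν := by
        refine tsum_congr fun g => ?_
        rw [← lintegral_indicator hS]
        refine lintegral_congr fun b => ?_
        by_cases hb : b ∈ S
        · simp only [hb, indicator_of_mem]
          exact lintegral_mul_const _ ((hu g).comp measurable_prodMk_left).coe_nnreal_ennreal
        · simp [hb]
    _ = ∑' g : G, ∫⁻ b, (∫⁻ b', S.indicator (fun x => (u g x b' : ℝ≥0∞)) (g • b) * rnAct ν g b ∂ν)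
          * f b ∂ν := by
        refine tsum_congr fun g => ?_
        have hm : Measurable fun b =>
            (∫⁻ b', S.indicator (fun x => (u g x b' : ℝ≥0∞)) (g • b) ∂ν) * f b :=
          ((hi g).comp (hs g)).lintegral_prod_right'.mul hf
        have := hq.lintegral_inv_smul g hm
        simp only [smul_inv_smul] at this
        rw [this]
        refine lintegral_congr fun b => ?_
        have hib : Measurable fun b' => S.indicator (fun x => (u g x b' : ℝ≥0∞)) (g • b) :=
          ((hi g).comp (hs g)).comp measurable_prodMk_left
        rw [lintegral_mul_const _ hib]
        ring
    _ ≤ C * ∫⁻ x, f x ∂ν := tsum_lintegral_mul_le hu' h hf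

end Transfer

/-! ### Sections of a function and their L¹ distance -/

section SectionDist

variable {X W : Type*} [MeasurableSpace X] [MeasurableSpace W] {ω : Measure W}

/-- The `L¹` distance between two sections of a function on `X × W`. -/
noncomputable def sectionDist (ω : Measure W) (f : X × W → ℝ) (x x' : X) : ℝ≥0∞ :=
  ∫⁻ w, ‖f (x, w) - f (x', w)‖ₑ ∂ω

lemma measurable_sectionDist [SFinite ω] {f : X × W → ℝ} (hf : Measurable f) :
    Measurable fun p : X × X => sectionDist ω f p.1 p.2 := by
  have : Measurable fun q : (X × X) × W => ‖f (q.1.1, q.2) - f (q.1.2, q.2)‖ₑ := by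
    fun_prop
  exact this.lintegral_prod_right'

lemma sectionDist_le_of_dist_le {f u : X × W → ℝ} (hf : Measurable f) (hu : Measurable u)
    {x x' : X} {η : ℝ} (h : ∀ w, dist (u (x, w)) (u (x', w)) ≤ η) :
    sectionDist ω f x x' ≤ (∫⁻ w, ‖f (x, w) - u (x, w)‖ₑ ∂ω) +
      (∫⁻ w, ‖f (x', w) - u (x', w)‖ₑ ∂ω) + ENNReal.ofReal η * ω univ := by
  rw [← lintegral_const, ← lintegral_add_left (by fun_prop), ← lintegral_add_left (by fun_prop)]
  refine lintegral_mono fun w => ?_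
  simp only [← edist_eq_enorm_sub]
  calc edist (f (x, w)) (f (x', w))
      ≤ edist (f (x, w)) (u (x, w)) + edist (u (x, w)) (u (x', w)) +
          edist (u (x', w)) (f (x', w)) :=
        edist_triangle4 _ _ _ _
    _ = edist (f (x, w)) (u (x, w)) + edist (f (x', w)) (u (x', w)) +
          edist (u (x, w)) (u (x', w)) := by
        rw [edist_comm (u (x', w)) (f (x', w))]; ring
    _ ≤ _ := by
        gcongr
        rw [edist_dist]
        exact ENNReal.ofReal_le_ofReal (h w)

end SectionDist

/-! ### Asymptotic closeness of sections -/

section Asymptotics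

variable {G : Type*} {X : Type*} [Group G] [Countable G] [MetricSpace X] [CompactSpace X]
  [MeasurableSpace X] [BorelSpace X] [MulAction G X] [MeasurableConstSMul G X] {ν : Measure X}
  [IsProbabilityMeasure ν] {Υ : ℕ → G → X → X → ℝ≥0} {Ω : ℕ → ℕ → Set X}
  {W : Type*} [MeasurableSpace W] {ω : Measure W}

variable [IsFiniteMeasure ω]

/-- The sections of an integrable function at `b` and `b'`, and at `g⁻¹ b` and `g⁻¹ b'`, are
asymptotically close on average with respect to an admissible family. -/
lemma IsRelativelyAdmissible.tendsto_sectionDist [StandardBorelSpace W]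
    (hadm : IsRelativelyAdmissible ν Υ Ω) (hq : IsQuasiInvariant G ν) (m : ℕ) {f : X × W → ℝ}
    (hf : Measurable f) (hfi : Integrable f (ν.prod ω)) :
    Tendsto (fun n => transfer ν (Υ n) (Ω n m) fun g p =>
      sectionDist ω f p.1 p.2 + sectionDist ω f (g⁻¹ • p.1) (g⁻¹ • p.2)) atTop (𝓝 0) := by
  obtain ⟨C, N, -, hC⟩ := hadm.bounded m
  obtain ⟨r, hr, hclose⟩ := hadm.close m
  rw [ENNReal.tendsto_nhds_zero]
  intro ε hε
  -- `K` collects the errors in units of η: 1 for the approximation error at `b`, C for each of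
  -- `b'`, `g⁻¹ • b`, `g⁻¹ • b'`, and the total mass of ω twice for the oscillation of `u`.
  set K : ℝ≥0∞ := 1 + 3 * ENNReal.ofReal C + 2 * ω univ with hKd
  have hK : K ≠ ∞ := by finiteness
  obtain ⟨η, hη, hηε⟩ := ENNReal.exists_nnreal_pos_mul_lt hK hε.ne'
  obtain ⟨u, hu, huf, huc⟩ := exists_uniform_approx hfi (ε := η) (by simpa using hη.ne')
  obtain ⟨δ, hδ, hδu⟩ := huc η hη
  set ψ : X → ℝ≥0∞ := fun x => ∫⁻ w, ‖f (x, w) - u (x, w)‖ₑ ∂ω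
  have hψ : Measurable ψ := by
    have : Measurable fun q : X × W => ‖f q - u q‖ₑ := by fun_prop
    exact this.lintegral_prod_right'
  have hψi : ∫⁻ x, ψ x ∂ν ≤ η := by
    rwa [lintegral_prod _ (by fun_prop)] at huf
  filter_upwards [eventually_gt_atTop N, eventually_gt_atTop 0, hr.eventually_lt_const hδ]
    with n hnN hn0 hnr
  obtain ⟨hC1, hC2, hC3⟩ := hC n hnN
  have hΩ := (hadm.isClosed n m).measurableSet
  have hm := hadm.measurable n
  have hsm : ∀ g : G, Measurable fun x : X => g⁻¹ • x := fun g => measurable_const_smul _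
  set c : ℝ≥0∞ := η * ω univ
  have e : ∀ g : G, ∀ p : X × X, p.1 ∈ Ω n m → 0 < Υ n g p.1 p.2 →
      sectionDist ω f p.1 p.2 + sectionDist ω f (g⁻¹ • p.1) (g⁻¹ • p.2) ≤
        ψ p.1 + (ψ p.2 + (ψ (g⁻¹ • p.1) + (ψ (g⁻¹ • p.2) + 2 * c))) := by
    intro g p hp hpΥ
    obtain ⟨h1, h2⟩ := hclose n g p.1 p.2 hp hpΥ
    have e1 := sectionDist_le_of_dist_le (ω := ω) hf hu fun w => (hδu _ _ w (h1.trans hnr)).le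
    have e2 := sectionDist_le_of_dist_le (ω := ω) hf hu fun w => (hδu _ _ w (h2.trans hnr)).le
    rw [ENNReal.ofReal_coe_nnreal] at e1 e2
    refine (add_le_add e1 e2).trans_eq ?_
    ring
  calc _ ≤ transfer ν (Υ n) (Ω n m) fun g p =>
        ψ p.1 + (ψ p.2 + (ψ (g⁻¹ • p.1) + (ψ (g⁻¹ • p.2) + 2 * c))) :=
        transfer_mono_ae hm hΩ fun g => ae_of_all _ (e g)
    _ = transfer ν (Υ n) (Ω n m) (fun _ p => ψ p.1) + (transfer ν (Υ n) (Ω n m) (fun _ p => ψ p.2)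
          + (transfer ν (Υ n) (Ω n m) (fun g p => ψ (g⁻¹ • p.1))
          + (transfer ν (Υ n) (Ω n m) (fun g p => ψ (g⁻¹ • p.2))
          + transfer ν (Υ n) (Ω n m) (fun _ _ => 2 * c)))) := by
        rw [transfer_add (φ := fun _ p => ψ p.1) fun _ => hψ.comp measurable_fst,
          transfer_add (φ := fun _ p => ψ p.2) fun _ => hψ.comp measurable_snd,
          transfer_add (φ := fun g p => ψ (g⁻¹ • p.1)) fun g =>
            hψ.comp ((hsm g).comp measurable_fst),
          transfer_add (φ := fun g p => ψ (g⁻¹ • p.2)) fun g =>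
            hψ.comp ((hsm g).comp measurable_snd)]
    _ ≤ η + (ENNReal.ofReal C * η + (ENNReal.ofReal C * η + (ENNReal.ofReal C * η + 2 * c))) := by
        gcongr ?_ + (?_ + (?_ + (?_ + ?_)))
        · rw [transfer_fst hm (hadm.normalized n hn0) hψ]
          exact (setLIntegral_le_lintegral _ _).trans hψi
        · exact (transfer_snd_le hm hC1 hψ).trans (by gcongr)
        · exact (transfer_inv_smul_fst_le hq hΩ hm hC3 hψ).trans (by gcongr)
        · exact (transfer_inv_smul_snd_le hq hm hC2 hψ).trans (by gcongr)
        · rw [transfer_fst (f := fun _ => 2 * c) hm (hadm.normalized n hn0) measurable_const,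
            setLIntegral_const]
          exact mul_le_of_le_one_right' prob_le_one
    _ = η * K := by rw [hKd]; ring
    _ ≤ ε := hηε.le

end Asymptotics

/-! ### A finite weight on the real line -/

section Weight

/-- A finite measure on `ℝ` equivalent to Lebesgue measure, which translations distort by a bounded
factor. -/
noncomputable def cauchyWeight : Measure ℝ :=
  volume.withDensity fun t => ENNReal.ofReal (1 + t ^ 2)⁻¹

instance : IsFiniteMeasure cauchyWeight :=
  isFiniteMeasure_withDensity_ofReal integrable_inv_one_add_sq.2

lemma ae_of_ae_cauchyWeight {p : ℝ → Prop} (h : ∀ᵐ t ∂cauchyWeight, p t) : ∀ᵐ t, p t := by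
  rw [cauchyWeight, ae_withDensity_iff (by fun_prop)] at h
  filter_upwards [h] with t ht
  exact ht (by positivity)

/-- The distortion of `cauchyWeight` under translation by `s`. -/
noncomputable def translationBound (s : ℝ) : ℝ≥0 := 2 * (1 + ‖s‖₊ ^ 2)

lemma translationBound_mono {s r : ℝ} (h : |s| ≤ r) : translationBound s ≤ translationBound r := by
  have : ‖s‖₊ ≤ ‖r‖₊ := by
    rw [← NNReal.coe_le_coe, coe_nnnorm, coe_nnnorm, Real.norm_eq_abs, Real.norm_eq_abs]
    exact h.trans (le_abs_self r)
  unfold translationBound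
  gcongr

lemma one_le_translationBound (s : ℝ) : 1 ≤ translationBound s := by
  rw [← NNReal.coe_le_coe]
  simp only [translationBound]
  push_cast
  nlinarith [sq_nonneg ‖s‖]

lemma lintegral_cauchyWeight_translate_le {φ : ℝ → ℝ≥0∞} (hφ : Measurable φ) (s : ℝ) :
    ∫⁻ t, φ (t + s) ∂cauchyWeight ≤ translationBound s * ∫⁻ t, φ t ∂cauchyWeight := by
  have hw : Measurable fun t : ℝ => ENNReal.ofReal (1 + t ^ 2)⁻¹ := by fun_prop
  rw [cauchyWeight, lintegral_withDensity_eq_lintegral_mul _ hw (by fun_prop),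
    lintegral_withDensity_eq_lintegral_mul _ hw hφ, ← lintegral_const_mul _ (hw.mul hφ),
    ← lintegral_add_right_eq_self (fun t => translationBound s *
      ((fun t : ℝ => ENNReal.ofReal (1 + t ^ 2)⁻¹) * φ) t) s]
  refine lintegral_mono fun t => ?_
  simp only [Pi.mul_apply]
  rw [← mul_assoc]
  gcongr
  rw [← ENNReal.ofReal_coe_nnreal, ← ENNReal.ofReal_mul (by positivity)]
  refine ENNReal.ofReal_le_ofReal ?_
  have hs : (translationBound s : ℝ) = 2 * (1 + s ^ 2) := by
    simp [translationBound]
  rw [hs, ← div_eq_mul_inv, inv_le_comm₀ (by positivity) (by positivity), inv_div,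
    div_le_iff₀ (by positivity)]
  nlinarith [sq_nonneg (t - s), sq_nonneg (t * s)]

variable {Y : Type*} [MeasurableSpace Y] {κ : Measure Y}

lemma lintegral_translate_le {φ : Y × ℝ → ℝ≥0∞} (hφ : Measurable φ) (s : ℝ) :
    ∫⁻ w, φ (w.1, w.2 + s) ∂κ.prod cauchyWeight ≤
      translationBound s * ∫⁻ w, φ w ∂κ.prod cauchyWeight := by
  rw [lintegral_prod (fun w : Y × ℝ => φ (w.1, w.2 + s)) (by fun_prop),
    lintegral_prod φ hφ.aemeasurable, ← lintegral_const_mul _ hφ.lintegral_prod_right']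
  exact lintegral_mono fun y =>
    lintegral_cauchyWeight_translate_le (hφ.comp measurable_prodMk_left) s

lemma lintegral_smul_translate_le {G : Type*} [Group G] [MulAction G Y] [MeasurableConstSMul G Y]
    [SFinite κ] [SMulInvariantMeasure G Y κ] {φ : Y × ℝ → ℝ≥0∞} (hφ : Measurable φ) (g : G)
    (s : ℝ) :
    ∫⁻ w, φ (g • w.1, w.2 + s) ∂κ.prod cauchyWeight ≤
      translationBound s * ∫⁻ w, φ w ∂κ.prod cauchyWeight := by
  have hmp := (measurePreserving_smul g κ).prod (MeasurePreserving.id cauchyWeight)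
  rw [← hmp.lintegral_comp hφ]
  exact lintegral_translate_le (hφ.comp hmp.measurable) s

end Weight

/-! ### Invariant functions on the Maharam extension and their translation defects -/

section InvariantFunction

variable {G : Type*} {X : Type*} [Group G] [MeasurableSpace X] [MulAction G X]
  {Y : Type*} [MeasurableSpace Y] [MulAction G Y]

/-- Bounded functions on the Maharam extension of `X × Y` which are invariant and Lipschitz in the
real coordinate. -/
structure IsMaharamInvariant (G : Type*) {X : Type*} [Group G] [MeasurableSpace X] [MulAction G X]
    {Y : Type*} [MeasurableSpace Y] [MulAction G Y] (ν : Measure X)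
    (f : X × (Y × ℝ) → ℝ) : Prop where
  measurable : Measurable f
  bounded : ∃ B, ∀ p, |f p| ≤ B
  lipschitz : ∀ x y t t', |f (x, (y, t)) - f (x, (y, t'))| ≤ |t - t'|
  invariant : ∀ᵐ x ∂ν, ∀ (g : G) y t, f (g • x, (g • y, t + logRN ν g x)) = f (x, (y, t))

/-- The `L¹` size of the difference between `f` and its translate by `s` over the point `x`. -/
noncomputable def translationDefect (κ : Measure Y) (f : X × (Y × ℝ) → ℝ) (x : X) (s : ℝ) :
    ℝ≥0∞ :=
  ∫⁻ w, ‖f (x, (w.1, w.2 + s)) - f (x, w)‖ₑ ∂κ.prod cauchyWeight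

variable {ν : Measure X} {κ : Measure Y} {f : X × (Y × ℝ) → ℝ}

lemma measurable_translationDefect [SFinite κ] (hf : Measurable f) :
    Measurable (Function.uncurry (translationDefect κ f)) := by
  have : Measurable fun q : (X × ℝ) × (Y × ℝ) =>
      ‖f (q.1.1, (q.2.1, q.2.2 + q.1.2)) - f (q.1.1, q.2)‖ₑ := by fun_prop
  exact this.lintegral_prod_right'

lemma translationDefect_lipschitz [IsFiniteMeasure κ] (hf : Measurable f)
    (hl : ∀ x y t t', |f (x, (y, t)) - f (x, (y, t'))| ≤ |t - t'|) (x : X) (s s' : ℝ) :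
    translationDefect κ f x s ≤ translationDefect κ f x s' +
      (κ.prod cauchyWeight univ).toNNReal * ENNReal.ofReal |s - s'| := by
  rw [ENNReal.coe_toNNReal (measure_ne_top _ _), mul_comm, ← lintegral_const, translationDefect,
    translationDefect, ← lintegral_add_left (by fun_prop)]
  refine lintegral_mono fun w => ?_
  simp only [← edist_eq_enorm_sub]
  refine (edist_triangle _ (f (x, (w.1, w.2 + s'))) _).trans ?_
  rw [add_comm]
  gcongr
  rw [edist_dist, Real.dist_eq]
  refine ENNReal.ofReal_le_ofReal ((hl _ _ _ _).trans_eq ?_)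
  congr 1
  ring

/-- Translating by `-s` compares the same two functions as translating by `s`, after a shift of the
real variable. Passing to |s| allows a period to be sought in an interval of positive numbers. -/
lemma translationDefect_abs_le (hf : Measurable f) (x : X) (s : ℝ) :
    translationDefect κ f x |s| ≤ translationBound s * translationDefect κ f x s := by
  rcases abs_choice s with h | h
  · rw [h]
    exact le_mul_of_one_le_left' (by exact_mod_cast one_le_translationBound s)
  · rw [h]
    have hφ : Measurable fun w : Y × ℝ => ‖f (x, (w.1, w.2 + s)) - f (x, w)‖ₑ := by fun_prop
    have := lintegral_translate_le (κ := κ) hφ (-s)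
    refine le_of_eq_of_le (lintegral_congr fun w => ?_) (this.trans_eq ?_)
    · rw [neg_add_cancel_right, ← edist_eq_enorm_sub, ← edist_eq_enorm_sub, edist_comm]
    · simp [translationBound, translationDefect]

variable [MeasurableConstSMul G Y] [SFinite κ] [SMulInvariantMeasure G Y κ]

/-- Invariance of `f` carries the integrand over `x` to the one over `g • x` by (y, t) ↦ (g y, t +
r), which preserves κ and distorts the weight by a bounded factor independent of `s`. -/
lemma translationDefect_compare (hf : Measurable f) {x : X} {g : G} {r : ℝ}
    (hx : ∀ y t, f (g • x, (g • y, t + r)) = f (x, (y, t))) (s : ℝ) :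
    translationDefect κ f x s ≤ translationBound r * translationDefect κ f (g • x) s := by
  have hφ : Measurable fun w : Y × ℝ =>
      ‖f (g • x, (w.1, w.2 + s)) - f (g • x, w)‖ₑ := by fun_prop
  refine le_of_eq_of_le (lintegral_congr fun w => ?_) (lintegral_smul_translate_le hφ g r)
  have e1 := hx w.1 w.2
  have e2 := hx w.1 (w.2 + s)
  rw [← e2, ← e1]
  ring_nf

/-- The cocycle increment along `g` between `x` and `x'` is nearly a period when the sections of
`f` over `x` and `x'`, and over `g x` and `g x'`, are close. -/
lemma translationDefect_increment_le (hf : Measurable f) {x x' : X} {g : G} {r r' : ℝ}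
    (hx : ∀ y t, f (g • x, (g • y, t + r)) = f (x, (y, t)))
    (hx' : ∀ y t, f (g • x', (g • y, t + r')) = f (x', (y, t))) {c : ℝ} (hc : |r| + |r'| ≤ c) :
    translationDefect κ f x |r - r'| ≤ translationBound c ^ 2 *
      (sectionDist (κ.prod cauchyWeight) f x x' +
        sectionDist (κ.prod cauchyWeight) f (g • x) (g • x')) := by
  have hs : |r - r'| ≤ c := (abs_sub r r').trans hc
  have hr : |r| ≤ c := le_trans (le_add_of_nonneg_right (abs_nonneg _)) hc
  have h1 : Measurable fun w : Y × ℝ => ‖f (x, w) - f (x', w)‖ₑ := by fun_prop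
  have h2 : Measurable fun w : Y × ℝ => ‖f (g • x, w) - f (g • x', w)‖ₑ := by fun_prop
  have e1 := lintegral_translate_le (κ := κ) h1 (r - r')
  have e2 := lintegral_smul_translate_le (κ := κ) h2 g r
  -- Go from x to x' at height t + (r - r'); apply g, which raises x' by r' and so reaches height t
  -- + r over g x'; pass to g x at that height, and return by g⁻¹ to x at height t.
  have key : translationDefect κ f x (r - r') ≤ translationBound c *
      (sectionDist (κ.prod cauchyWeight) f x x' +
        sectionDist (κ.prod cauchyWeight) f (g • x) (g • x')) := by
    calc translationDefect κ f x (r - r')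
        ≤ ∫⁻ w, (‖f (x, (w.1, w.2 + (r - r'))) - f (x', (w.1, w.2 + (r - r')))‖ₑ +
            ‖f (g • x, (g • w.1, w.2 + r)) - f (g • x', (g • w.1, w.2 + r))‖ₑ)
            ∂κ.prod cauchyWeight := by
          refine lintegral_mono fun w => ?_
          have i1 := hx w.1 w.2
          have i2 := hx' w.1 (w.2 + (r - r'))
          rw [show w.2 + (r - r') + r' = w.2 + r by ring] at i2
          rw [i1, i2]
          simp only [← edist_eq_enorm_sub]
          rw [edist_comm (f (x, (w.1, w.2)))]
          exact edist_triangle _ _ _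
      _ ≤ translationBound (r - r') * sectionDist (κ.prod cauchyWeight) f x x' +
            translationBound r * sectionDist (κ.prod cauchyWeight) f (g • x) (g • x') := by
          rw [lintegral_add_left (by fun_prop)]
          exact add_le_add e1 e2
      _ ≤ _ := by
          rw [mul_add]
          gcongr
          · exact translationBound_mono hs
          · exact translationBound_mono hr
  calc translationDefect κ f x |r - r'|
      ≤ translationBound (r - r') * translationDefect κ f x (r - r') :=
        translationDefect_abs_le hf x _
    _ ≤ translationBound c * (translationBound c *
      (sectionDist (κ.prod cauchyWeight) f x x' +
        sectionDist (κ.prod cauchyWeight) f (g • x) (g • x'))) := by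
        gcongr
        exact translationBound_mono hs
    _ = _ := by rw [← mul_assoc, sq]

end InvariantFunction

/-! ### Translation defects are period defects -/

section Periods

variable {G : Type*} {X : Type*} [Group G] [Countable G] [MetricSpace X] [CompactSpace X]
  [MeasurableSpace X] [BorelSpace X] [MulAction G X] [MeasurableConstSMul G X] {ν : Measure X}
  [IsProbabilityMeasure ν] {Υ : ℕ → G → X → X → ℝ≥0} {Ω : ℕ → ℕ → Set X}
  {Y : Type*} [MeasurableSpace Y] [MulAction G Y] [StandardBorelSpace Y] [MeasurableConstSMul G Y]
  {κ : Measure Y} [IsFiniteMeasure κ] [SMulInvariantMeasure G Y κ]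

/-- The translation defect of an invariant function on the Maharam extension is a period defect. -/
theorem IsMaharamInvariant.isPeriodDefect (hadm : IsRelativelyAdmissible ν Υ Ω)
    (hq : IsQuasiInvariant G ν) (m : ℕ) {f : X × (Y × ℝ) → ℝ} (hf : IsMaharamInvariant G ν f) :
    IsPeriodDefect ν Υ (fun n => Ω n m) (translationDefect κ f) where
  measurable := measurable_translationDefect hf.measurable
  lipschitz := ⟨_, translationDefect_lipschitz hf.measurable hf.lipschitz⟩
  compare := by
    intro g
    filter_upwards [hf.invariant] with x hx
    exact ⟨_, translationDefect_compare hf.measurable (hx g)⟩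
  tendsto := by
    obtain ⟨C, N, -, hC⟩ := hadm.cocycle m
    obtain ⟨B, hB⟩ := hf.bounded
    have hint : Integrable f (ν.prod (κ.prod cauchyWeight)) :=
      .of_bound hf.measurable.aestronglyMeasurable B (ae_of_all _ hB)
    -- The bound C on the cocycle makes the distortion factor uniform in g and in the pair of
    -- points.
    have hlim := ENNReal.Tendsto.const_mul (a := (translationBound C : ℝ≥0∞) ^ 2)
      (hadm.tendsto_sectionDist hq m hf.measurable hint) (Or.inr (by finiteness))
    rw [mul_zero] at hlim
    refine tendsto_of_tendsto_of_tendsto_of_le_of_le' tendsto_const_nhds hlim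
      (Eventually.of_forall fun _ => zero_le) ?_
    filter_upwards [eventually_gt_atTop N] with n hn
    have hm : ∀ g : G, Measurable fun p : X × X =>
        sectionDist (κ.prod cauchyWeight) f p.1 p.2 +
          sectionDist (κ.prod cauchyWeight) f (g⁻¹ • p.1) (g⁻¹ • p.2) := by
      intro g
      have h := measurable_sectionDist (ω := κ.prod cauchyWeight) hf.measurable
      exact h.add (h.comp (((measurable_const_smul _).comp measurable_fst).prodMk
        ((measurable_const_smul _).comp measurable_snd)))
    rw [← transfer_const_mul hm]
    refine transfer_mono_ae (hadm.measurable n) (hadm.isClosed n m).measurableSet fun g => ?_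
    filter_upwards [hC n hn g, Measure.quasiMeasurePreserving_fst.ae hf.invariant,
      Measure.quasiMeasurePreserving_snd.ae hf.invariant] with p hp h1 h2 hpΩ hpΥ
    exact translationDefect_increment_le hf.measurable (h1 g⁻¹) (h2 g⁻¹) (hp hpΩ hpΥ).1.le

end Periods

/-! ### The invariant function attached to a set A -/

section ReturnFunction

variable {G : Type*} {X : Type*} [Group G] [MeasurableSpace X] [MulAction G X]
  {Y : Type*} [MulAction G Y] {ν : Measure X} {A : Set (X × Y)} {δ : ℝ}

open Classical in
/-- The contribution of `g` to `returnFunction`. -/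
noncomputable def returnTent (ν : Measure X) (A : Set (X × Y)) (δ : ℝ) (g : G)
    (p : X × (Y × ℝ)) : ℝ :=
  if (g • p.1, g • p.2.1) ∈ A then max 0 (δ - |p.2.2 + logRN ν g p.1|) else 0

/-- A Lipschitz version of the indicator function of the saturation of `A × (-δ, δ)` in the
Maharam extension. -/
noncomputable def returnFunction (G : Type*) {X : Type*} [Group G] [MeasurableSpace X]
    [MulAction G X] {Y : Type*} [MulAction G Y] (ν : Measure X)
    (A : Set (X × Y)) (δ : ℝ) (p : X × (Y × ℝ)) : ℝ :=
  ⨆ g : G, returnTent ν A δ g p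

lemma returnTent_nonneg (g : G) (p : X × (Y × ℝ)) : 0 ≤ returnTent ν A δ g p := by
  unfold returnTent
  split_ifs
  · exact le_max_left _ _
  · exact le_rfl

lemma returnTent_le (hδ : 0 ≤ δ) (g : G) (p : X × (Y × ℝ)) : returnTent ν A δ g p ≤ δ := by
  unfold returnTent
  split_ifs
  · exact max_le hδ (sub_le_self _ (abs_nonneg _))
  · exact hδ

lemma returnTent_lipschitz (g : G) (x : X) (y : Y) (t t' : ℝ) :
    returnTent ν A δ g (x, (y, t)) ≤ returnTent ν A δ g (x, (y, t')) + |t - t'| := by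
  unfold returnTent
  simp only
  split_ifs
  · refine max_le (by positivity) ?_
    have h1 := abs_sub_abs_le_abs_sub (t' + logRN ν g x) (t + logRN ν g x)
    rw [add_sub_add_right_eq_sub, abs_sub_comm] at h1
    have h2 := le_max_right 0 (δ - |t' + logRN ν g x|)
    linarith
  · simp

lemma bddAbove_returnTent (hδ : 0 ≤ δ) (p : X × (Y × ℝ)) :
    BddAbove (range fun g : G => returnTent ν A δ g p) :=
  ⟨δ, by rintro _ ⟨g, rfl⟩; exact returnTent_le hδ g p⟩

lemma returnTent_pos {g : G} {x : X} {y : Y} {t : ℝ} (h : 0 < returnTent ν A δ g (x, (y, t))) :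
    (g • x, g • y) ∈ A ∧ |t + logRN ν g x| < δ := by
  unfold returnTent at h
  split_ifs at h with hA
  · refine ⟨hA, ?_⟩
    rcases lt_max_iff.1 h with h | h
    · exact absurd h (lt_irrefl 0)
    · linarith
  · exact absurd h (lt_irrefl 0)

lemma exists_of_returnFunction_pos {x : X} {y : Y} {t : ℝ}
    (h : 0 < returnFunction G ν A δ (x, (y, t))) :
    ∃ g : G, (g • x, g • y) ∈ A ∧ |t + logRN ν g x| < δ := by
  by_contra! hcon
  refine h.not_ge (ciSup_le fun g => ?_)
  by_contra! hg
  obtain ⟨h1, h2⟩ := returnTent_pos hg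
  exact absurd h2 (not_lt.2 (hcon g h1))

lemma returnFunction_pos (hδ : 0 ≤ δ) {x : X} (hx : IsCocyclePoint G ν x) {y : Y} {t : ℝ}
    (hA : (x, y) ∈ A) (ht : |t| < δ) : 0 < returnFunction G ν A δ (x, (y, t)) := by
  refine lt_of_lt_of_le ?_ (le_ciSup (bddAbove_returnTent hδ _) (1 : G))
  have : 0 < δ - |t| := by linarith
  simpa [returnTent, hA, hx.one] using this

lemma isMaharamInvariant_returnFunction [Countable G] [MeasurableConstSMul G X]
    [MeasurableSpace Y] [MeasurableConstSMul G Y] [IsFiniteMeasure ν] (hq : IsQuasiInvariant G ν)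
    (hA : MeasurableSet A) (hδ : 0 ≤ δ) : IsMaharamInvariant G ν (returnFunction G ν A δ) where
  measurable := by
    refine Measurable.iSup fun g => Measurable.ite ?_ ?_ measurable_const
    · have : Measurable fun p : X × (Y × ℝ) => (g • p.1, g • p.2.1) :=
        ((measurable_const_smul g).comp measurable_fst).prodMk
          ((measurable_const_smul g).comp (measurable_fst.comp measurable_snd))
      exact this hA
    · have := (measurable_logRN (μ := ν) g).comp 
        (measurable_fst : Measurable (Prod.fst : X × (Y × ℝ) → X))
      exact measurable_const.max (measurable_const.sub
        ((measurable_snd.comp measurable_snd).add this).abs)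
  bounded := ⟨δ, fun p => by
    have h0 : 0 ≤ returnFunction G ν A δ p :=
      (returnTent_nonneg 1 p).trans (le_ciSup (bddAbove_returnTent hδ p) (1 : G))
    rw [abs_of_nonneg h0]
    exact ciSup_le fun g => returnTent_le hδ g p⟩
  lipschitz := by
    have key : ∀ x y t t', returnFunction G ν A δ (x, (y, t)) ≤
        returnFunction G ν A δ (x, (y, t')) + |t - t'| := fun x y t t' =>
      ciSup_le fun g => (returnTent_lipschitz g x y t t').trans
        (add_le_add_left (le_ciSup (bddAbove_returnTent hδ _) g) _)
    intro x y t t'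
    have h1 := key x y t t'
    have h2 := key x y t' t
    rw [abs_sub_comm t' t] at h2
    rw [abs_le]
    constructor <;> linarith
  invariant := by
    filter_upwards [hq.ae_isCocyclePoint (G := G)] with x hx g y t
    -- Reindexing h ↦ h g turns the supremum at the translated point into the one at the original
    -- point, by the cocycle identity.
    refine (Equiv.mulRight g).iSup_congr fun h => ?_
    classical
    refine if_congr (by simp only [Equiv.coe_mulRight, mul_smul]) ?_ rfl
    simp only [Equiv.coe_mulRight, hx h g]
    rw [add_assoc, add_comm (logRN ν g x)]

end ReturnFunction

/-! ### From common periods to the theorem -/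

section Main

universe u v

/-- A weak mixing action is ergodic. -/
lemma IsWeakMixing.isErgodicAction {G : Type u} {X : Type v} [Group G] [MeasurableSpace X]
    [MulAction G X] {ν : Measure X} (hq : IsQuasiInvariant G ν) (h : IsWeakMixing G ν) :
    IsErgodicAction G ν where
  quasiInvariant := hq
  ae_const := by
    intro S hS hinv
    -- Weak mixing is applied to the trivial action on a point.
    have : MeasurableConstSMul G Unit := ⟨fun _ => measurable_id⟩
    have : ErgodicSMul G Unit (Measure.dirac ()) :=
      { measure_preimage_smul := fun _ _ _ => rfl
        aeconst_of_forall_preimage_smul_ae_eq := fun _ _ => .of_subsingleton_left }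
    have he := (h Unit (Measure.dirac ())).ae_const (Prod.fst ⁻¹' S) (measurable_fst hS) fun g =>
      Measure.quasiMeasurePreserving_fst.ae_eq_comp (hinv g)
    have hnull : ∀ T : Set X, (ν.prod (Measure.dirac ())) (Prod.fst ⁻¹' T) = ν T := by
      intro T
      have : Prod.fst ⁻¹' T = T ×ˢ (univ : Set Unit) := by ext; simp
      rw [this, Measure.prod_prod, measure_univ, mul_one]
    rw [eventuallyConst_set] at he ⊢
    refine he.imp (fun h => ?_) fun h => ?_
    · exact ae_iff.2 ((hnull _).symm.trans (ae_iff.1 h))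
    · exact ae_iff.2 ((hnull _).symm.trans (ae_iff.1 h))

variable {G : Type u} {X : Type v} [Group G] [Countable G] [MeasurableSpace X] [MulAction G X]
  [MeasurableConstSMul G X] {ν : Measure X} [IsProbabilityMeasure ν]

/-- A common period of the invariant functions on the Maharam extension yields an element of the
ratio set. -/
lemma isLogRatio_of_translationDefect_eq_zero (hq : IsQuasiInvariant G ν)
    {Y : Type*} [MeasurableSpace Y] [MulAction G Y] [MeasurableConstSMul G Y]
    {κ : Measure Y} [IsProbabilityMeasure κ] [SMulInvariantMeasure G Y κ] {s : ℝ} (hs : s ≠ 0)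
    (h : ∀ f : X × (Y × ℝ) → ℝ, IsMaharamInvariant G ν f →
      ∀ᵐ x ∂ν, translationDefect κ f x s = 0) : IsLogRatio G (ν.prod κ) (-s) := by
  intro A hA hpos ε' hε'
  -- Tolerance at most |s| excludes the identity, whose logarithmic derivative is 0.
  set ε := min ε' |s| with hεd
  have hε : 0 < ε := lt_min hε' (abs_pos.2 hs)
  set R : G → Set (X × Y) := fun g => {p | g • p ∈ A ∧ |logRN ν g p.1 + s| < ε}
  have hR : ∀ g, MeasurableSet (R g) := by
    intro g
    have h1 : MeasurableSet {p : X × Y | g • p ∈ A} := measurable_const_smul g hA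
    have h2 : Measurable fun p : X × Y => |logRN ν g p.1 + s| :=
      (((measurable_logRN g).comp measurable_fst).add_const s).abs
    exact h1.inter (measurableSet_lt h2 measurable_const)
  have hf := isMaharamInvariant_returnFunction (G := G) hq hA (half_pos hε).le
  -- Over a point of `A` the return function, taken with δ = ε/2, is positive for |t| < ε/2.
  -- Periodicity makes it positive at t + s for some such t, so some g returns the point to `A` with
  -- |t + s + R(g, x)| < ε/2, hence |R(g, x) + s| < ε.
  have hnull : ν.prod κ (A \ ⋃ g, R g) = 0 := by
    rw [Measure.measure_prod_null (hA.diff (MeasurableSet.iUnion hR))]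
    filter_upwards [h _ hf, hq.ae_isCocyclePoint (G := G)] with x hx hxc
    have hm := hf.measurable
    rw [translationDefect, lintegral_eq_zero_iff (by fun_prop)] at hx
    have hy := Measure.ae_ae_of_ae_prod hx
    refine measure_eq_zero_iff_ae_notMem.2 ?_
    filter_upwards [hy] with y hy hyA
    -- Periodicity holds for almost every t, hence on a dense set, which meets the ball around 0.
    obtain ⟨t, ht1, ht2⟩ := (Measure.dense_of_ae (ae_of_ae_cauchyWeight hy)).exists_mem_open
      (Metric.isOpen_ball (x := (0 : ℝ)) (ε := ε / 2)) ⟨0, Metric.mem_ball_self (half_pos hε)⟩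
    simp only [Pi.zero_apply, enorm_eq_zero, sub_eq_zero, mem_ofPred_eq] at ht1
    have ht3 : |t| < ε / 2 := by simpa using ht2
    have hp := returnFunction_pos (half_pos hε).le hxc hyA.1 ht3
    rw [← ht1] at hp
    obtain ⟨g, hg1, hg2⟩ := exists_of_returnFunction_pos hp
    refine hyA.2 (mem_iUnion.2 ⟨g, hg1, ?_⟩)
    have := abs_sub (t + s + logRN ν g x) t
    rw [show t + s + logRN ν g x - t = logRN ν g x + s by ring] at this
    simp only
    linarith
  obtain ⟨g, hg⟩ : ∃ g, 0 < ν.prod κ (A ∩ R g) := by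
    by_contra! hcon
    apply hpos.ne'
    refine measure_mono_null (t := (A \ ⋃ g, R g) ∪ ⋃ g, A ∩ R g) ?_ ?_
    · rw [← inter_iUnion, sdiff_union_inter]
    · exact measure_union_null hnull (measure_iUnion_null fun g => nonpos_iff_eq_zero.1 (hcon g))
  refine ⟨g, fun h1 => ?_, ?_⟩
  · apply hg.ne'
    refine measure_mono_null_ae (t := ∅) ?_ measure_empty
    filter_upwards [Measure.quasiMeasurePreserving_fst.ae (hq.ae_isCocyclePoint (G := G))]
      with p hp hpR
    have := hpR.2.2
    rw [h1, hp.one, zero_add] at this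
    exact absurd this (not_lt.2 (min_le_right _ _))
  · rw [pos_iff_ne_zero] at hg ⊢
    intro h0
    apply hg
    refine measure_mono_null_ae ?_ h0
    filter_upwards [hq.logRN_prod (κ := κ)] with p hp hpR
    refine ⟨hpR.1, hpR.2.1, ?_⟩
    rw [hp, sub_neg_eq_add]
    exact hpR.2.2.trans_le (min_le_left _ _)

end Main

/-- An ergodic action with a relatively admissible family has a nontrivial stable ratio. -/
theorem exists_isStableLogRatio {G : Type*} [Group G] [Countable G]
    {X : Type*} [MetricSpace X] [CompactSpace X] [MeasurableSpace X] [BorelSpace X]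
    [MulAction G X] [MeasurableConstSMul G X] {ν : Measure X} [IsProbabilityMeasure ν]
    (he : IsErgodicAction G ν) {Υ : ℕ → G → X → X → ℝ≥0} {Ω : ℕ → ℕ → Set X}
    (hadm : IsRelativelyAdmissible ν Υ Ω) : ∃ a ≠ 0, IsStableLogRatio G ν a := by
  have hq := he.quasiInvariant
  obtain ⟨D, -, hD0, hD⟩ := hadm.large
  obtain ⟨m, hm⟩ := (hD0.eventually_lt_const (show (0 : ℝ) < 1 / 4 by norm_num)).exists
  obtain ⟨C, N, hC, hcoc⟩ := hadm.cocycle m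
  -- The increments lie in [1/C, C); the lower end is halved to put them inside an open interval
  -- that still stays away from 0.
  obtain ⟨s, hs, h⟩ := exists_forall_isPeriodDefect_zero (Υ := Υ) (Ω := fun n => Ω n m)
    (a := 1 / (2 * C)) (c := C) he hadm.measurable (fun n => (hadm.isClosed n m).measurableSet)
    (fun n => by
      have h1 := hD n m
      have h2 : (3 / 4 : ℝ) ≤ ν.real (Ω n m) := by linarith
      have h3 := ENNReal.ofReal_le_ofReal h2
      rw [ofReal_measureReal] at h3
      refine le_of_eq_of_le ?_ h3
      rw [ENNReal.ofReal_div_of_pos (by norm_num)]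
      norm_num)
    hadm.normalized (by
      filter_upwards [eventually_gt_atTop N] with n hn g
      filter_upwards [hcoc n hn g] with p hp hpΩ hpΥ
      obtain ⟨h1, h2⟩ := hp hpΩ hpΥ
      refine ⟨lt_of_lt_of_le ?_ h2, lt_of_le_of_lt (abs_sub _ _) h1⟩
      exact one_div_lt_one_div_of_lt hC (by linarith))
  have hs0 : 0 < s := lt_of_lt_of_le (by positivity) hs.1
  refine ⟨-s, neg_ne_zero.2 hs0.ne', fun Y _ _ _ _ κ _ _ => ?_⟩
  exact isLogRatio_of_translationDefect_eq_zero hq hs0.ne' fun f hf =>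
    h _ (hf.isPeriodDefect hadm hq m)

end StableType

theorem corollary2p3 {G : Type*} [Group G] [Countable G]
    {X : Type*} [MetricSpace X] [CompactSpace X] [MeasurableSpace X] [BorelSpace X]
    [MulAction G X] [MeasurableConstSMul G X]
    (ν : MeasureTheory.Measure X) [MeasureTheory.IsProbabilityMeasure ν]
    (hquasi : StableType.IsQuasiInvariant G ν)
    (hmix : StableType.IsWeakMixing G ν)
    (hadm : ∃ (Υ : ℕ → G → X → X → NNReal) (Ω : ℕ → ℕ → Set X),
      StableType.IsRelativelyAdmissible ν Υ Ω) :
    (∃ lam : ℝ, 1 ≤ lam ∧ StableType.HasStableTypeIII G ν lam) ∧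
      ¬ StableType.stableRatioSet G ν ⊆ {(0 : EReal), 1, ⊤} := by
  obtain ⟨Υ, Ω, hadm⟩ := hadm
  obtain ⟨a, ha, h⟩ := StableType.exists_isStableLogRatio (hmix.isErgodicAction hquasi) hadm
  exact StableType.hasStableTypeIII_of_isStableLogRatio hquasi ha h
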